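/- Let $\mathbb H$ be the quaternions, $\mathbb S^2$ the sphere of purely imaginary unit quaternions, $\mathbb B=\{q\in\mathbb H: |q|<1\}$, $\mathbb E=\mathbb B\setminus(-1,0]$, and for $\mathbf i\in\mathbb S^2$ let $\mathbb C(\mathbf i)=\{x+\mathbf i y: x,y\in\mathbb R\}$ and $\mathbb E_{\mathbf i}=\mathbb E\cap\mathbb C(\mathbf i)$. Let $\mathcal{SR}(\mathbb E)$ be the set of slice regular functions on $\mathbb E$, that is, of real differentiable $f:\mathbb E\to\mathbb H$ such that $\left(\frac{\partial}{\partial x}+\mathbf j\frac{\partial}{\partial y}\right)f(x+\mathbf jy)=0$ on $\mathbb E_{\mathbf j}$ for every $\mathbf j\in\mathbb S^2$. Let $\alpha\in(0,1]$, $\sigma\in(0,1]$ and $k\in\{1,2,\dots\}\cup\{\infty\}$. For $q\in\mathbb E$ let $q^\alpha=\exp\bigl(\alpha(\ln|q|+I_q\operatorname{Arg}q)\bigr)$ be the principal power, computed in the complex plane $\mathbb C(I_q)$ containing $q$, and let $e_m(q)=\sum_{n=0}^m q^n/n!$, with $e_\infty=\exp$. Assume that $e_{k-1}(q^\alpha)\neq0$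 for all $q\in\mathbb E$ (where $\infty-1=\infty$). Fix $\mathbf i\in\mathbb S^2$. For $f\in\mathcal{SR}(\mathbb E)$ and $z\in\mathbb E_{\mathbf i}$ put $$\frac{d^\sigma}{dq_{\alpha,k,\mathbf i}}f(z)=(1-\sigma)f(z)+\sigma\lim_{\mathbb E_{\mathbf i}\ni\zeta\to z}\bigl(e_k(z^\alpha)-e_k(\zeta^\alpha)\bigr)^{-1}\bigl(f(z)-f(\zeta)\bigr).$$ Let $\mathfrak D^\sigma_{\alpha,k,\mathbf i}$ be the set of $f\in\mathcal{SR}(\mathbb E)$ for which $\int_{\mathbb E_{\mathbf i}}\bigl|\frac{d^\sigma}{dq_{\alpha,k,\mathbf i}}f(z)\bigr|^2d\mu(z)<\infty$, where $\mu$ is the area measure on $\mathbb C(\mathbf i)$, and let $$\|f\|_{\mathfrak D^\sigma_{\alpha,k,\mathbf i}}=\left(\alpha\,|f(\tfrac12)|^2+\int_{\mathbb E_{\mathbf i}}\Bigl|\frac{d^\sigma}{dq_{\alpha,k,\mathbf i}}f(z)\Bigr|^2d\mu(z)\right)^{1/2}.$$ Then the limit above exists for all $f\in\mathcal{SR}(\mathbb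 E)$ and $z\in\mathbb E_{\mathbf i}$, and $(\mathfrak D^\sigma_{\alpha,k,\mathbf i},\|\cdot\|_{\mathfrak D^\sigma_{\alpha,k,\mathbf i}})$, with the pointwise operations, is a quaternionic Banach right-module: $\mathfrak D^\sigma_{\alpha,k,\mathbf i}$ is a right $\mathbb H$-module; $\|\cdot\|_{\mathfrak D^\sigma_{\alpha,k,\mathbf i}}$ is a norm on it with $\|fa\|_{\mathfrak D^\sigma_{\alpha,k,\mathbf i}}=\|f\|_{\mathfrak D^\sigma_{\alpha,k,\mathbf i}}\,|a|$ for all $a\in\mathbb H$; and every Cauchy sequence in this norm converges to an element of $\mathfrak D^\sigma_{\alpha,k,\mathbf i}$. -/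

import Mathlib

open Filter Topology MeasureTheory
open scoped Quaternion

namespace SliceDirichlet

noncomputable section

/-- The sphere `𝕊²` of purely imaginary unit quaternions. -/
def imSphere : Set ℍ[ℝ] := {I | I.re = 0 ∧ ‖I‖ = 1}

/-- The parametrization `x + y√-1 ↦ x + I y` of the complex plane `ℂ(I)`, `I ∈ 𝕊²`. -/
def sliceEmb (I : ℍ[ℝ]) (w : ℂ) : ℍ[ℝ] := (w.re : ℍ[ℝ]) + I * (w.im : ℍ[ℝ])

/-- The slice `Ω_I = Ω ∩ ℂ(I)`. -/
def slice (I : ℍ[ℝ]) (Ω : Set ℍ[ℝ]) : Set ℍ[ℝ] := Ω ∩ Set.range (sliceEmb I)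

/-- The domain `𝔼 = 𝔹 ∖ (-1, 0]`, where `𝔹` is the open unit ball of the quaternions. -/
def domE : Set ℍ[ℝ] := Metric.ball 0 1 \ {q | q.im = 0 ∧ -1 < q.re ∧ q.re ≤ 0}

/-- Slice regularity of `f` on an (open) set `Ω` of quaternions: `f` is real differentiable and
`(∂/∂x + I ∂/∂y) f(x + I y) = 0` on every slice `Ω_I`. -/
def SliceRegularOn (f : ℍ[ℝ] → ℍ[ℝ]) (Ω : Set ℍ[ℝ]) : Prop :=
  DifferentiableOn ℝ f Ω ∧
    ∀ I ∈ imSphere, ∀ x y : ℝ, (x : ℍ[ℝ]) + I * (y : ℍ[ℝ]) ∈ Ω →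
      deriv (fun t : ℝ => f ((t : ℍ[ℝ]) + I * (y : ℍ[ℝ]))) x
        + I * deriv (fun t : ℝ => f ((x : ℍ[ℝ]) + I * (t : ℍ[ℝ]))) y = 0

/-- A function on `𝔼`, extended by zero to all quaternions. As `𝔼` is open, the extension does not
influence derivatives and limits at the points of `𝔼`. -/
def ext (f : domE → ℍ[ℝ]) : ℍ[ℝ] → ℍ[ℝ] := Function.extend Subtype.val f 0

/-- The set `𝒮ℛ(𝔼)` of slice regular functions on `𝔼`. -/
def SR : Set (domE → ℍ[ℝ]) := {f | SliceRegularOn (ext f) domE}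

/-- The principal logarithm `ln |q| + I_q Arg q` where `q = a + I_q b`, `I_q = q.im / |q.im|`,
`b = |q.im|`, and `Arg q` is the principal argument of `a + b√-1` (for a positive real number `q`
the second summand is `0`). -/
def qlog (q : ℍ[ℝ]) : ℍ[ℝ] :=
  (Real.log ‖q‖ : ℍ[ℝ]) + (Complex.arg ⟨q.re, ‖q.im‖⟩ / ‖q.im‖) • q.im

/-- The principal power `q ^ α = exp (α (ln |q| + I_q Arg q))`. -/
def qpow (q : ℍ[ℝ]) (α : ℝ) : ℍ[ℝ] := NormedSpace.exp (α • qlog q)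

/-- The truncated exponential `e_k(q) = ∑_{n ≤ k} q ^ n / n!`, and `e_∞ = exp`. -/
def truncExp (k : ℕ∞) (q : ℍ[ℝ]) : ℍ[ℝ] :=
  if k = ⊤ then NormedSpace.exp q
  else ∑ n ∈ Finset.range (k.toNat + 1), ((n.factorial : ℝ)⁻¹) • q ^ n

/-- The difference quotient with respect to the fractal measure `q ↦ e_k(q ^ α)`. -/
def fractalQuot (α : ℝ) (k : ℕ∞) (f : domE → ℍ[ℝ]) (z ζ : ℍ[ℝ]) : ℍ[ℝ] :=
  (truncExp k (qpow z α) - truncExp k (qpow ζ α))⁻¹ * (ext f z - ext f ζ)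

/-- `f` has the fractal derivative `d` at `z` along the slice `𝔼_i`: the difference quotients
converge to `d` as `ζ → z`, `ζ ∈ 𝔼_i ∖ {z}`. -/
def HasFractalDeriv (α : ℝ) (k : ℕ∞) (i : ℍ[ℝ]) (f : domE → ℍ[ℝ]) (z d : ℍ[ℝ]) : Prop :=
  Tendsto (fractalQuot α k f z) (𝓝[slice i domE \ {z}] z) (𝓝 d)

/-- The fractal derivative along the slice `𝔼_i`, i.e. the limit of the difference quotients. -/
def fractalDeriv (α : ℝ) (k : ℕ∞) (i : ℍ[ℝ]) (f : domE → ℍ[ℝ]) (z : ℍ[ℝ]) : ℍ[ℝ] :=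
  limUnder (𝓝[slice i domE \ {z}] z) (fractalQuot α k f z)

/-- The fractal-fractional `i`-derivative of order `σ` (with `β = 1`, `χ₁ = 1 - σ`, `χ₀ = σ`). -/
def ffDeriv (α σ : ℝ) (k : ℕ∞) (i : ℍ[ℝ]) (f : domE → ℍ[ℝ]) (z : ℍ[ℝ]) : ℍ[ℝ] :=
  (1 - σ) • ext f z + σ • fractalDeriv α k i f z

/-- The integrand `‖(d^σ / dq_{α,k,i}) f‖²` on the slice, in the coordinate `w ∈ ℂ ≅ ℂ(i)`. -/
def energyDensity (α σ : ℝ) (k : ℕ∞) (i : ℍ[ℝ]) (f : domE → ℍ[ℝ]) (w : ℂ) : ℝ :=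
  ‖ffDeriv α σ k i f (sliceEmb i w)‖ ^ 2

/-- The Dirichlet type space: slice regular functions on `𝔼` whose fractal-fractional
`i`-derivative is square integrable on `𝔼_i` with respect to the area measure. -/
def dirichletSpace (α σ : ℝ) (k : ℕ∞) (i : ℍ[ℝ]) : Set (domE → ℍ[ℝ]) :=
  {f | f ∈ SR ∧ IntegrableOn (energyDensity α σ k i f) (sliceEmb i ⁻¹' domE) volume}

/-- The norm `(α ‖f(1/2)‖² + ∫_{𝔼_i} ‖(d^σ / dq_{α,k,i}) f‖² dμ)^{1/2}`. -/
def dirichletNorm (α σ : ℝ) (k : ℕ∞) (i : ℍ[ℝ]) (f : domE → ℍ[ℝ]) : ℝ :=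
  Real.sqrt (α * ‖ext f (((1 / 2 : ℝ)) : ℍ[ℝ])‖ ^ 2
    + ∫ w in sliceEmb i ⁻¹' domE, energyDensity α σ k i f w)

/-- `S`, with the operations of the ambient quaternionic right module `V` and the norm `N`, is a
quaternionic Banach right module. Right modules over `ℍ` are modules over `ℍᵐᵒᵖ`:
`MulOpposite.op a • f` is `f a`. -/
structure IsBanachRightModule {V : Type*} [AddCommGroup V] [Module (ℍ[ℝ])ᵐᵒᵖ V]
    (S : Set V) (N : V → ℝ) : Prop where
  zero_mem : (0 : V) ∈ S
  add_mem : ∀ f ∈ S, ∀ g ∈ S, f + g ∈ S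
  smul_mem : ∀ f ∈ S, ∀ a : ℍ[ℝ], MulOpposite.op a • f ∈ S
  norm_nonneg : ∀ f ∈ S, 0 ≤ N f
  norm_eq_zero_iff : ∀ f ∈ S, (N f = 0 ↔ f = 0)
  norm_add_le : ∀ f ∈ S, ∀ g ∈ S, N (f + g) ≤ N f + N g
  norm_smul : ∀ f ∈ S, ∀ a : ℍ[ℝ], N (MulOpposite.op a • f) = N f * ‖a‖
  complete : ∀ u : ℕ → V, (∀ n, u n ∈ S) →
    (∀ ε > 0, ∃ n₀, ∀ m ≥ n₀, ∀ n ≥ n₀, N (u m - u n) < ε) →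
    ∃ f ∈ S, Tendsto (fun n => N (u n - f)) atTop (𝓝 0)

end

end SliceDirichlet

/-!
The norm of `f` depends only on the restriction of `f` to the slice `ℂ(i)`. Multiplication from
the left by `ℂ(i)` makes the quaternions a complex Banach space `LeftSlice i`, and `mem_SR_iff`
says that slice regular functions are the real differentiable functions whose restrictions to all
slices are holomorphic with values in these Banach spaces. Restriction to one slice is injective
(`eq_zero_of_sliceFun_eqOn_zero`, the identity theorem applied on the real interval which all
slices share) and onto the holomorphic functions (`exists_mem_SR_sliceFun_eqOn`, the
representation formula). At real points the extended function is differentiable because the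
representation formula reproduces affine functions and at most doubles a bound on remainders.

In the slice coordinate `w` the fractal measure is the holomorphic function `φ(w) = e_k(w ^ α)`,
with derivative `e_{k-1}(w ^ α) α w ^ (α - 1)`, which has no zeros by assumption. Therefore the
limit of the difference quotients exists and equals `φ'⁻¹ F'`, where `F` is the restriction of
`f`, and the fractal-fractional derivative is `D F = (1 - σ) F + σ φ'⁻¹ F'` (`ffDeriv_sliceEmb`).

The analytic core is `exists_norm_le_of_isCompact`: on compact sets `F` is bounded by a constant
times `‖F(1/2)‖ + ‖D F‖`, the second norm being that of `L²`. Indeed `D F` is holomorphic, so the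
area mean value property bounds it locally uniformly by its `L²` norm. With `a = (1 - σ) / σ`, one
has `(exp (a φ) F)' = exp (a φ) (φ' / σ) D F`, and integrating along segments from `1/2`, with
respect to which the slit disc is star-shaped, bounds `F`.

Definiteness of the norm follows at once. For completeness, a Cauchy sequence converges locally
uniformly on the slice, hence together with its derivatives; the limit extends to a slice regular
function, and Fatou's lemma gives convergence in norm.
-/

namespace SliceDirichlet

noncomputable section

/-! ### Area mean values and point evaluation in `L²` -/

section Holomorphic

open Metric

variable {X : Type*} [NormedAddCommGroup X] [NormedSpace ℂ X]

/-- The area mean value property, obtained from circle averages in polar coordinates. -/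
theorem setIntegral_ball_eq_smul_of_differentiableOn [CompleteSpace X] {f : ℂ → X} {z : ℂ}
    {r : ℝ} (hr : 0 < r)
    (hf : DifferentiableOn ℂ f (closedBall z r)) :
    ∫ w in ball z r, f w = (Real.pi * r ^ 2) • f z := by
  have hpi := Real.pi_pos
  have hcirc : ∀ ρ ∈ Set.Ioo (0 : ℝ) r,
      ∫ θ in Set.Ioo (-Real.pi) Real.pi, f (z + Complex.polarCoord.symm (ρ, θ))
        = (2 * Real.pi) • f z := by
    intro ρ hρ
    have h1 : Real.circleAverage f z ρ = f z := by
      apply DiffContOnCl.circleAverage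
      rw [abs_of_pos hρ.1]
      apply DifferentiableOn.diffContOnCl
      rw [closure_ball _ hρ.1.ne']
      exact hf.mono (closedBall_subset_closedBall hρ.2.le)
    rw [Real.circleAverage_eq_integral_add (-Real.pi),
      intervalIntegral.integral_comp_add_right (fun θ => f (circleMap z ρ θ)),
      show (0 : ℝ) + -Real.pi = -Real.pi by ring, show 2 * Real.pi + -Real.pi = Real.pi by ring,
      intervalIntegral.integral_of_le (by linarith), integral_Ioc_eq_integral_Ioo] at h1
    rw [← h1, smul_inv_smul₀ (by positivity)]
    refine setIntegral_congr_fun measurableSet_Ioo fun θ _ => ?_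
    simp [circleMap, Complex.exp_mul_I]
  have hcont : ContinuousOn (fun p : ℝ × ℝ => p.1 • f (z + Complex.polarCoord.symm p))
      (Set.Icc 0 r ×ˢ Set.Icc (-Real.pi) Real.pi) := by
    refine continuousOn_fst.smul (hf.continuousOn.comp ?_ ?_)
    · simp only [Complex.polarCoord_symm_apply]
      fun_prop
    · rintro p ⟨hp, -⟩
      simpa [abs_of_nonneg hp.1] using hp.2
  have hint : IntegrableOn (fun p : ℝ × ℝ => p.1 • f (z + Complex.polarCoord.symm p))
      (Set.Ioo 0 r ×ˢ Set.Ioo (-Real.pi) Real.pi) (volume.prod volume) := by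
    refine IntegrableOn.mono_set ?_ (Set.prod_mono Set.Ioo_subset_Icc_self Set.Ioo_subset_Icc_self)
    exact hcont.integrableOn_compact (isCompact_Icc.prod isCompact_Icc)
  calc ∫ w in ball z r, f w
      = ∫ w, (ball 0 r).indicator (fun w => f (z + w)) w := by
        rw [← integral_indicator measurableSet_ball, ← integral_add_left_eq_self _ z]
        refine integral_congr_ae (Eventually.of_forall fun w => ?_)
        simp [Set.indicator]
    _ = ∫ p in Complex.polarCoord.target,
          p.1 • (ball 0 r).indicator (fun w => f (z + w)) (Complex.polarCoord.symm p) :=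
        (Complex.integral_comp_polarCoord_symm _).symm
    _ = ∫ p in Set.Ioo 0 r ×ˢ Set.Ioo (-Real.pi) Real.pi,
          p.1 • f (z + Complex.polarCoord.symm p) := by
        rw [← integral_indicator Complex.polarCoord.open_target.measurableSet,
          ← integral_indicator (measurableSet_Ioo.prod measurableSet_Ioo)]
        refine integral_congr_ae (Eventually.of_forall fun p => ?_)
        by_cases hp : p ∈ Complex.polarCoord.target
        · rw [Set.indicator_of_mem hp]
          have hp' : 0 < p.1 ∧ p.2 ∈ Set.Ioo (-Real.pi) Real.pi := hp
          by_cases h : p.1 < r <;>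
            simp [Set.indicator, h, hp'.1, hp'.2.1, hp'.2.2, abs_of_pos hp'.1]
        · rw [Set.indicator_of_notMem hp, Set.indicator_of_notMem fun h => hp ⟨h.1.1, h.2⟩]
    _ = ∫ ρ in Set.Ioo 0 r, ρ • ((2 * Real.pi) • f z) := by
        rw [Measure.volume_eq_prod, setIntegral_prod _ hint]
        refine setIntegral_congr_fun measurableSet_Ioo fun ρ hρ => ?_
        simp only
        rw [integral_smul, hcirc ρ hρ]
    _ = (Real.pi * r ^ 2) • f z := by
        rw [integral_smul_const, ← integral_Ioc_eq_integral_Ioo,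
          ← intervalIntegral.integral_of_le hr.le, integral_id, smul_smul]
        congr 1
        ring

/-- Point evaluations are bounded on square integrable holomorphic functions, with a constant
which depends only on the radius of a disc contained in the domain. -/
theorem norm_le_eLpNorm_of_closedBall_subset [CompleteSpace X] {f : ℂ → X} {U : Set ℂ}
    {z : ℂ} {r : ℝ} (hr : 0 < r)
    (hU : closedBall z r ⊆ U) (hf : DifferentiableOn ℂ f U)
    (hL : MemLp f 2 (volume.restrict U)) :
    ‖f z‖ ≤ (Real.sqrt Real.pi * r)⁻¹ * (eLpNorm f 2 (volume.restrict U)).toReal := by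
  have hpi := Real.pi_pos
  have hle : volume.restrict (ball z r) ≤ volume.restrict U :=
    Measure.restrict_mono (ball_subset_closedBall.trans hU) le_rfl
  have hLb : MemLp f 2 (volume.restrict (ball z r)) := hL.mono_measure hle
  have hfin : IsFiniteMeasure (volume.restrict (ball z r)) :=
    ⟨by rw [Measure.restrict_apply_univ]; exact measure_ball_lt_top⟩
  have h1 : ‖(Real.pi * r ^ 2) • f z‖ ≤ (eLpNorm f 1 (volume.restrict (ball z r))).toReal := by
    rw [← setIntegral_ball_eq_smul_of_differentiableOn hr (hf.mono hU),
      eLpNorm_one_eq_lintegral_enorm]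
    have hi : Integrable f (volume.restrict (ball z r)) := hLb.integrable (by norm_num)
    rw [← integral_norm_eq_lintegral_enorm hi.1]
    exact norm_integral_le_integral_norm _
  have h2 : eLpNorm f 1 (volume.restrict (ball z r))
      ≤ eLpNorm f 2 (volume.restrict U) * ENNReal.ofReal (Real.sqrt Real.pi * r) := by
    refine (eLpNorm_le_eLpNorm_mul_rpow_measure_univ one_le_two hLb.1).trans ?_
    refine mul_le_mul' (eLpNorm_mono_measure _ hle) (le_of_eq ?_)
    rw [Measure.restrict_apply_univ, Complex.volume_ball,
      show ENNReal.ofReal r ^ 2 * (NNReal.pi : ENNReal) = ENNReal.ofReal (r ^ 2 * Real.pi) by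
        rw [ENNReal.ofReal_mul (by positivity), ENNReal.ofReal_pow hr.le]
        congr 1
        exact (ENNReal.ofReal_coe_nnreal (p := NNReal.pi)).symm,
      ENNReal.ofReal_rpow_of_nonneg (by positivity) (by norm_num)]
    congr 1
    norm_num
    rw [← Real.sqrt_eq_rpow, Real.sqrt_mul (by positivity), Real.sqrt_sq hr.le]
    ring
  have h3 := ENNReal.toReal_mono (ENNReal.mul_ne_top hL.2.ne ENNReal.ofReal_ne_top) h2
  rw [ENNReal.toReal_mul, ENNReal.toReal_ofReal (by positivity)] at h3
  rw [norm_smul, Real.norm_of_nonneg (by positivity)] at h1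
  have hs : Real.sqrt Real.pi * Real.sqrt Real.pi = Real.pi := Real.mul_self_sqrt hpi.le
  have hsp : 0 < Real.sqrt Real.pi * r := by positivity
  rw [← div_eq_inv_mul, le_div_iff₀ hsp]
  refine le_of_mul_le_mul_right ?_ hsp
  calc ‖f z‖ * (√Real.pi * r) * (√Real.pi * r) = Real.pi * r ^ 2 * ‖f z‖ := by
        linear_combination ‖f z‖ * r ^ 2 * hs
    _ ≤ _ := h1.trans h3

/-! ### The first order operator on holomorphic functions -/

/-- The operator `F ↦ (1 - σ) F + σ (φ')⁻¹ F'` on holomorphic functions with values in a complex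
Banach space. -/
def mixedDeriv (σ : ℝ) (φ : ℂ → ℂ) (F : ℂ → X) (w : ℂ) : X :=
  ((1 - σ : ℝ) : ℂ) • F w + (σ : ℂ) • ((deriv φ w)⁻¹ • deriv F w)

/-- With `a = (1 - σ) / σ`, multiplication by the integrating factor `exp (a φ)` turns
`mixedDeriv σ φ` into a plain derivative. -/
theorem hasDerivAt_exp_smul {σ : ℝ} (hσ : σ ≠ 0) {φ : ℂ → ℂ} {F : ℂ → X} {w : ℂ}
    (hφ : DifferentiableAt ℂ φ w) (hφ' : deriv φ w ≠ 0) (hF : DifferentiableAt ℂ F w) :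
    HasDerivAt (fun w => Complex.exp ((1 - σ) / σ * φ w) • F w)
      ((Complex.exp ((1 - σ) / σ * φ w) * deriv φ w / σ) • mixedDeriv σ φ F w) w := by
  have hσ' : (σ : ℂ) ≠ 0 := by exact_mod_cast hσ
  convert ((hφ.hasDerivAt.const_mul ((1 - σ : ℂ) / σ)).cexp).smul hF.hasDerivAt using 1
  · rfl
  rw [mixedDeriv]
  match_scalars
  · field_simp
  · field_simp

theorem differentiableOn_mixedDeriv [CompleteSpace X] {σ : ℝ} {φ : ℂ → ℂ} {F : ℂ → X}
    {U : Set ℂ} (hU : IsOpen U)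
    (hφ : DifferentiableOn ℂ φ U) (hφ' : ∀ w ∈ U, deriv φ w ≠ 0) (hF : DifferentiableOn ℂ F U) :
    DifferentiableOn ℂ (mixedDeriv σ φ F) U :=
  (hF.const_smul _).add (((hφ.deriv hU).inv hφ').smul (hF.deriv hU) |>.const_smul _)

/-- On a compact subset of a star-shaped domain, a holomorphic function is controlled by its value
at the centre and the `L²` norm of `mixedDeriv σ φ F`: point evaluations bound `mixedDeriv σ φ F`
on the segments to the centre, and integrating along them recovers `F`. -/
theorem exists_norm_le_of_isCompact [CompleteSpace X] {σ : ℝ} (hσ : σ ≠ 0)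
    {φ : ℂ → ℂ} {U : Set ℂ} {c : ℂ}
    (hU : IsOpen U) (hc : StarConvex ℝ c U)
    (hφ : DifferentiableOn ℂ φ U) (hφ' : ∀ w ∈ U, deriv φ w ≠ 0)
    {K : Set ℂ} (hK : IsCompact K) (hKU : K ⊆ U) :
    ∃ C : ℝ, 0 ≤ C ∧ ∀ F : ℂ → X, DifferentiableOn ℂ F U →
      MemLp (mixedDeriv σ φ F) 2 (volume.restrict U) → ∀ z ∈ K,
      ‖F z‖ ≤ C * (‖F c‖ + (eLpNorm (mixedDeriv σ φ F) 2 (volume.restrict U)).toReal) := by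
  -- The union of the segments from `c` to the points of `K`, a compact subset of `U`.
  set S : Set ℂ := (fun p : ℝ × ℂ => c + p.1 • (p.2 - c)) '' (Set.Icc 0 1 ×ˢ K) with hS
  have hSc : IsCompact S := (isCompact_Icc.prod hK).image (by fun_prop)
  have hSU : S ⊆ U := by
    rintro _ ⟨⟨t, z⟩, ⟨ht, hz⟩, rfl⟩
    exact hc.add_smul_sub_mem (hKU hz) ht.1 ht.2
  have hseg : ∀ z ∈ K, segment ℝ c z ⊆ S := by
    intro z hz w hw
    rw [segment_eq_image'] at hw
    obtain ⟨t, ht, rfl⟩ := hw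
    exact ⟨(t, z), ⟨ht, hz⟩, rfl⟩
  obtain ⟨r, hr, hrU⟩ := hSc.exists_cthickening_subset_open hU hSU
  set a : ℂ := (1 - σ) / σ with ha
  have hE : ContinuousOn (fun w => Complex.exp (a * φ w)) U :=
    (hφ.continuousOn.const_mul a |>.cexp : _)
  obtain ⟨M, hM⟩ := hSc.exists_bound_of_continuousOn
    (f := fun w => Complex.exp (a * φ w) * deriv φ w / σ)
    (((hE.mul (hφ.deriv hU).continuousOn).div_const _).mono hSU)
  obtain ⟨B, hB⟩ := hK.exists_bound_of_continuousOn
    (f := fun w => Complex.exp (-(a * φ w)))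
    ((hφ.continuousOn.const_mul a).neg.cexp.mono hKU)
  obtain ⟨R, hR⟩ := hK.exists_bound_of_continuousOn (f := fun w => w - c) (by fun_prop)
  set A := ‖Complex.exp (a * φ c)‖
  set P := (Real.sqrt Real.pi * r)⁻¹ with hP
  have hP0 : 0 ≤ P := by positivity
  refine ⟨|B| * (A + |M| * P * |R|), by positivity, fun F hF hL z hz => ?_⟩
  set N := (eLpNorm (mixedDeriv σ φ F) 2 (volume.restrict U)).toReal with hN
  have hN0 : 0 ≤ N := ENNReal.toReal_nonneg
  have hbound : ∀ w ∈ S, ‖mixedDeriv σ φ F w‖ ≤ P * N := fun w hw =>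
    norm_le_eLpNorm_of_closedBall_subset hr
      ((closedBall_subset_cthickening hw r).trans hrU)
      (differentiableOn_mixedDeriv hU hφ hφ' hF) hL
  have hmv := (convex_segment (𝕜 := ℝ) c z).norm_image_sub_le_of_norm_hasDerivWithin_le
    (f := fun w => Complex.exp (a * φ w) • F w) (C := |M| * (P * N))
    (fun w hw => (hasDerivAt_exp_smul hσ (hφ.differentiableAt (hU.mem_nhds (hSU (hseg z hz hw))))
      (hφ' w (hSU (hseg z hz hw)))
      (hF.differentiableAt (hU.mem_nhds (hSU (hseg z hz hw))))).hasDerivWithinAt)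
    (fun w hw => by
      rw [norm_smul]
      exact mul_le_mul ((hM w (hseg z hz hw)).trans (le_abs_self _)) (hbound w (hseg z hz hw))
        (norm_nonneg _) (abs_nonneg _))
    (left_mem_segment ℝ c z) (right_mem_segment ℝ c z)
  have hv : ‖Complex.exp (a * φ z) • F z‖ ≤ A * ‖F c‖ + |M| * (P * N) * |R| := by
    have h1 := norm_sub_norm_le (Complex.exp (a * φ z) • F z) (Complex.exp (a * φ c) • F c)
    have h2 : |M| * (P * N) * ‖z - c‖ ≤ |M| * (P * N) * |R| := by
      gcongr
      exact (hR z hz).trans (le_abs_self _)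
    rw [norm_smul (Complex.exp (a * φ c))] at h1
    linarith
  calc ‖F z‖ = ‖Complex.exp (-(a * φ z)) • Complex.exp (a * φ z) • F z‖ := by
        rw [smul_smul, ← Complex.exp_add, neg_add_cancel, Complex.exp_zero, one_smul]
    _ ≤ |B| * (A * ‖F c‖ + |M| * (P * N) * |R|) := by
        rw [norm_smul]
        exact mul_le_mul ((hB z hz).trans (le_abs_self _)) hv (norm_nonneg _) (abs_nonneg _)
    _ ≤ |B| * (A + |M| * P * |R|) * (‖F c‖ + N) := by
        have h1 : 0 ≤ |M| * P * |R| * ‖F c‖ := by positivity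
        have h2 : 0 ≤ A * N := by positivity
        have h3 : 0 ≤ |B| := abs_nonneg B
        nlinarith [mul_nonneg h3 h1, mul_nonneg h3 h2]

theorem mixedDeriv_add {σ : ℝ} {φ : ℂ → ℂ} {F G : ℂ → X} {w : ℂ}
    (hF : DifferentiableAt ℂ F w) (hG : DifferentiableAt ℂ G w) :
    mixedDeriv σ φ (F + G) w = mixedDeriv σ φ F w + mixedDeriv σ φ G w := by
  simp only [mixedDeriv, Pi.add_apply, deriv_add hF hG]
  module

theorem mixedDeriv_clm_comp {σ : ℝ} {φ : ℂ → ℂ} {F : ℂ → X} {w : ℂ} (L : X →L[ℂ] X)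
    (hF : DifferentiableAt ℂ F w) :
    mixedDeriv σ φ (fun w => L (F w)) w = L (mixedDeriv σ φ F w) := by
  have h : deriv (fun w => L (F w)) w = L (deriv F w) :=
    (L.hasFDerivAt.comp_hasDerivAt w hF.hasDerivAt).deriv
  simp only [mixedDeriv, h, map_add, map_smul]

theorem mixedDeriv_sub {σ : ℝ} {φ : ℂ → ℂ} {F G : ℂ → X} {w : ℂ}
    (hF : DifferentiableAt ℂ F w) (hG : DifferentiableAt ℂ G w) :
    mixedDeriv σ φ (F - G) w = mixedDeriv σ φ F w - mixedDeriv σ φ G w := by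
  simp only [mixedDeriv, Pi.sub_apply, deriv_sub hF hG]
  module

/-- A sequence of holomorphic functions which is Cauchy for the norms of
`exists_norm_le_of_isCompact` has a holomorphic limit. -/
theorem exists_limit_of_cauchy_mixedDeriv [CompleteSpace X] {σ : ℝ} (hσ : σ ≠ 0)
    {φ : ℂ → ℂ} {U : Set ℂ} {c : ℂ}
    (hU : IsOpen U) (hc : StarConvex ℝ c U)
    (hφ : DifferentiableOn ℂ φ U) (hφ' : ∀ w ∈ U, deriv φ w ≠ 0)
    (F : ℕ → ℂ → X) (hF : ∀ n, DifferentiableOn ℂ (F n) U)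
    (hL : ∀ n, MemLp (mixedDeriv σ φ (F n)) 2 (volume.restrict U))
    (hcauchy : ∀ ε > 0, ∃ n₀, ∀ m ≥ n₀, ∀ n ≥ n₀, ‖F m c - F n c‖
      + (eLpNorm (mixedDeriv σ φ (F m) - mixedDeriv σ φ (F n)) 2 (volume.restrict U)).toReal < ε) :
    ∃ G : ℂ → X, DifferentiableOn ℂ G U ∧ (∀ w ∈ U, Tendsto (fun n => F n w) atTop (𝓝 (G w))) ∧
      ∀ w ∈ U, Tendsto (fun n => mixedDeriv σ φ (F n) w) atTop (𝓝 (mixedDeriv σ φ G w)) := by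
  have hsub : ∀ m n, mixedDeriv σ φ (F m - F n)
      =ᵐ[volume.restrict U] mixedDeriv σ φ (F m) - mixedDeriv σ φ (F n) := fun m n =>
    (ae_restrict_mem hU.measurableSet).mono fun w hw => mixedDeriv_sub
      ((hF m).differentiableAt (hU.mem_nhds hw)) ((hF n).differentiableAt (hU.mem_nhds hw))
  have huc : ∀ K ⊆ U, IsCompact K → UniformCauchySeqOn F atTop K := by
    intro K hKU hK
    obtain ⟨C, hC0, hC⟩ := exists_norm_le_of_isCompact (X := X) hσ hU hc hφ hφ' hK hKU
    rw [Metric.uniformCauchySeqOn_iff]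
    intro ε hε
    obtain ⟨n₀, hn₀⟩ := hcauchy (ε / (C + 1)) (by positivity)
    refine ⟨n₀, fun m hm n hn z hz => ?_⟩
    have h := hC (F m - F n) ((hF m).sub (hF n))
      ((memLp_congr_ae (hsub m n)).2 ((hL m).sub (hL n))) z hz
    rw [eLpNorm_congr_ae (hsub m n)] at h
    have h' := hn₀ m hm n hn
    rw [lt_div_iff₀ (by positivity)] at h'
    rw [dist_eq_norm]
    simp only [Pi.sub_apply] at h
    refine h.trans_lt (lt_of_le_of_lt ?_ h')
    rw [mul_comm C]
    gcongr
    linarith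
  have hpt : ∀ w ∈ U, ∃ x, Tendsto (fun n => F n w) atTop (𝓝 x) := fun w hw =>
    cauchySeq_tendsto_of_complete
      ((huc {w} (by simpa using hw) isCompact_singleton).cauchySeq (Set.mem_singleton w))
  choose! G hG using hpt
  have hloc : TendstoLocallyUniformlyOn F G atTop U := by
    rw [tendstoLocallyUniformlyOn_iff_forall_isCompact hU]
    exact fun K hKU hK => (huc K hKU hK).tendstoUniformlyOn_of_tendsto fun w hw => hG w (hKU hw)
  refine ⟨G, hloc.differentiableOn (Eventually.of_forall hF) hU, hG, fun w hw => ?_⟩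
  exact ((hG w hw).const_smul _).add
    ((((hloc.deriv (Eventually.of_forall hF) hU).tendsto_at hw).const_smul _).const_smul _)

end Holomorphic

/-! ### Complex planes in the quaternions -/

theorem mul_self_of_mem_imSphere {I : ℍ[ℝ]} (hI : I ∈ imSphere) : I * I = -1 := by
  have h1 : star I = -I := by
    rw [Quaternion.star_eq_neg]
    exact hI.1
  have h2 := Quaternion.self_mul_star I
  rw [h1, Quaternion.normSq_eq_norm_mul_self, hI.2] at h2
  simpa [neg_eq_iff_eq_neg] using h2

/-- The inclusion of the complex plane `ℂ(I)` as a homomorphism of real algebras. -/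
def sliceHom (I : imSphere) : ℂ →ₐ[ℝ] ℍ[ℝ] :=
  Complex.lift ⟨I, mul_self_of_mem_imSphere I.2⟩

theorem sliceHom_apply (I : imSphere) (w : ℂ) : sliceHom I w = sliceEmb I w := by
  change algebraMap ℝ ℍ[ℝ] w.re + w.im • (I : ℍ[ℝ]) = _
  rw [sliceEmb, ← Quaternion.coe_commutes, Quaternion.coe_mul_eq_smul]
  rfl

theorem sliceEmb_eq (I : ℍ[ℝ]) (w : ℂ) : sliceEmb I w = (w.re : ℍ[ℝ]) + w.im • I := by
  rw [sliceEmb, ← Quaternion.coe_commutes, Quaternion.coe_mul_eq_smul]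

theorem sliceEmb_ofReal (I : ℍ[ℝ]) (x : ℝ) : sliceEmb I x = x := by
  simp [sliceEmb]

theorem sliceEmb_sub {I : ℍ[ℝ]} (hI : I ∈ imSphere) (z w : ℂ) :
    sliceEmb I (z - w) = sliceEmb I z - sliceEmb I w := by
  simpa only [sliceHom_apply] using map_sub (sliceHom ⟨I, hI⟩) z w

theorem sliceEmb_inv {I : ℍ[ℝ]} (hI : I ∈ imSphere) (w : ℂ) :
    sliceEmb I w⁻¹ = (sliceEmb I w)⁻¹ := by
  simpa only [sliceHom_apply] using map_inv₀ (sliceHom ⟨I, hI⟩) w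

theorem re_sliceEmb {I : ℍ[ℝ]} (hI : I ∈ imSphere) (w : ℂ) : (sliceEmb I w).re = w.re := by
  simp [sliceEmb_eq, hI.1]

theorem im_sliceEmb {I : ℍ[ℝ]} (hI : I ∈ imSphere) (w : ℂ) : (sliceEmb I w).im = w.im • I := by
  have h : I.im = I := by
    apply Quaternion.ext <;> simp [hI.1]
  rw [sliceEmb_eq, Quaternion.im_add, Quaternion.im_smul, Quaternion.im_coe, h, zero_add]

theorem norm_im_sliceEmb {I : ℍ[ℝ]} (hI : I ∈ imSphere) (w : ℂ) :
    ‖(sliceEmb I w).im‖ = |w.im| := by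
  rw [im_sliceEmb hI, norm_smul, hI.2, mul_one, Real.norm_eq_abs]

theorem norm_sq_eq_re_sq_add_norm_im_sq (q : ℍ[ℝ]) : ‖q‖ ^ 2 = q.re ^ 2 + ‖q.im‖ ^ 2 := by
  rw [sq ‖q‖, sq ‖q.im‖, ← Quaternion.normSq_eq_norm_mul_self,
    ← Quaternion.normSq_eq_norm_mul_self, Quaternion.normSq_def', Quaternion.normSq_def']
  simp
  ring

theorem norm_sliceEmb {I : ℍ[ℝ]} (hI : I ∈ imSphere) (w : ℂ) : ‖sliceEmb I w‖ = ‖w‖ := by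
  have h := norm_sq_eq_re_sq_add_norm_im_sq (sliceEmb I w)
  rw [re_sliceEmb hI, norm_im_sliceEmb hI, sq_abs] at h
  rw [← sq_eq_sq₀ (norm_nonneg _) (norm_nonneg _), h, Complex.sq_norm, Complex.normSq_apply]
  ring

theorem isometry_sliceEmb {I : ℍ[ℝ]} (hI : I ∈ imSphere) : Isometry (sliceEmb I) :=
  Isometry.of_dist_eq fun z w => by
    rw [dist_eq_norm, dist_eq_norm, ← sliceEmb_sub hI, norm_sliceEmb hI]

theorem sliceEmb_exp {I : ℍ[ℝ]} (hI : I ∈ imSphere) (w : ℂ) :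
    sliceEmb I (Complex.exp w) = NormedSpace.exp (sliceEmb I w) := by
  have hc : Continuous (sliceHom ⟨I, hI⟩) := by
    have := (isometry_sliceEmb hI).continuous
    rwa [show ⇑(sliceHom ⟨I, hI⟩) = sliceEmb I from funext (sliceHom_apply ⟨I, hI⟩)]
  have h := NormedSpace.map_exp (sliceHom ⟨I, hI⟩) hc w
  rw [← Complex.exp_eq_exp_ℂ] at h
  simpa only [sliceHom_apply] using h

/-- The slit unit disc, which is the coordinate domain of every slice of `domE`. -/
def slitDisc : Set ℂ := Metric.ball 0 1 ∩ Complex.slitPlane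

theorem isOpen_slitDisc : IsOpen slitDisc := Metric.isOpen_ball.inter Complex.isOpen_slitPlane

theorem starConvex_slitDisc : StarConvex ℝ ((1 / 2 : ℝ) : ℂ) slitDisc := by
  refine StarConvex.inter ((convex_ball _ _).starConvex ?_)
    (Complex.starConvex_ofReal_slitPlane (by norm_num))
  simp
  norm_num

theorem half_mem_slitDisc : ((1 / 2 : ℝ) : ℂ) ∈ slitDisc := by
  constructor
  · simp
    norm_num
  · exact Complex.ofReal_mem_slitPlane.2 (by norm_num)

theorem isPreconnected_slitDisc : IsPreconnected slitDisc :=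
  (starConvex_slitDisc.isPathConnected half_mem_slitDisc).isConnected.isPreconnected

theorem preimage_sliceEmb_domE {I : ℍ[ℝ]} (hI : I ∈ imSphere) :
    sliceEmb I ⁻¹' domE = slitDisc := by
  have hI0 : I ≠ 0 := by
    rintro rfl
    simpa using hI.2
  ext w
  simp only [domE, slitDisc, Set.mem_preimage, Set.mem_sdiff, mem_ball_zero_iff,
    norm_sliceEmb hI, Set.mem_ofPred_eq, im_sliceEmb hI, re_sliceEmb hI, smul_eq_zero, hI0,
    or_false, Set.mem_inter_iff, Complex.mem_slitPlane_iff]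
  refine and_congr_right fun hw => ?_
  have h1 := neg_le_of_abs_le (Complex.abs_re_le_norm w)
  have h2 : -1 < w.re := by linarith
  grind

theorem slice_domE {I : ℍ[ℝ]} (hI : I ∈ imSphere) : slice I domE = sliceEmb I '' slitDisc := by
  rw [slice, ← preimage_sliceEmb_domE hI, Set.image_preimage_eq_inter_range]

theorem sliceEmb_mem_domE {I : ℍ[ℝ]} (hI : I ∈ imSphere) {w : ℂ} :
    sliceEmb I w ∈ domE ↔ w ∈ slitDisc := by
  rw [← preimage_sliceEmb_domE hI, Set.mem_preimage]

theorem isOpen_domE : IsOpen domE := by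
  have : domE = Metric.ball 0 1 \ {q : ℍ[ℝ] | q.im = 0 ∧ q.re ≤ 0} := by
    ext q
    simp only [domE, Set.mem_sdiff, mem_ball_zero_iff, Set.mem_ofPred_eq]
    refine and_congr_right fun hq => not_congr (and_congr_right fun him => ?_)
    have h := norm_sq_eq_re_sq_add_norm_im_sq q
    rw [him, norm_zero] at h
    have : -1 < q.re := by nlinarith [norm_nonneg q]
    simp [this]
  rw [this]
  refine Metric.isOpen_ball.sdiff ((isClosed_eq Quaternion.continuous_im continuous_const).inter
    (isClosed_le Quaternion.continuous_re continuous_const))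

/-! ### The fractal measure in slice coordinates -/

/-- The truncated exponential `e_k` of a complex variable, with `e_∞ = exp`. -/
def complexTruncExp (k : ℕ∞) (z : ℂ) : ℂ :=
  if k = ⊤ then Complex.exp z
  else ∑ n ∈ Finset.range (k.toNat + 1), ((n.factorial : ℝ)⁻¹) • z ^ n

theorem hasDerivAt_complexTruncExp {k : ℕ∞} (hk : 1 ≤ k) (z : ℂ) :
    HasDerivAt (complexTruncExp k) (complexTruncExp (k - 1) z) z := by
  induction k using ENat.recTopCoe with
  | top =>
    have h : complexTruncExp ⊤ = Complex.exp := funext fun z => by simp [complexTruncExp]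
    rw [show (⊤ : ℕ∞) - 1 = ⊤ from rfl, h]
    exact Complex.hasDerivAt_exp z
  | coe k =>
    obtain ⟨m, rfl⟩ : ∃ m, k = m + 1 := ⟨k - 1, by
      have : 1 ≤ k := by exact_mod_cast hk
      omega⟩
    have h0 : ((m + 1 : ℕ) : ℕ∞) - 1 = (m : ℕ) := by
      rw [← Nat.cast_one (R := ℕ∞), ← ENat.natCast_sub, Nat.add_sub_cancel]
    have h1 : complexTruncExp ((m + 1 : ℕ) : ℕ∞)
        = fun z => ∑ n ∈ Finset.range (m + 2), ((n.factorial : ℝ)⁻¹) • z ^ n :=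
      funext fun z => by
        rw [complexTruncExp, if_neg (ENat.natCast_ne_top _), ENat.toNat_natCast]
    rw [h0, h1, complexTruncExp, if_neg (ENat.natCast_ne_top _), ENat.toNat_natCast]
    have h2 := HasDerivAt.fun_sum (u := Finset.range (m + 2))
      (A := fun n z => ((n.factorial : ℝ)⁻¹) • z ^ n)
      (A' := fun n => ((n.factorial : ℝ)⁻¹) • (n * z ^ (n - 1)))
      (fun n _ => (hasDerivAt_pow n z).const_smul ((n.factorial : ℝ)⁻¹))
    refine h2.congr_deriv ?_
    rw [Finset.sum_range_succ']
    simp only [Nat.cast_zero, zero_mul, smul_zero, add_zero]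
    refine Finset.sum_congr rfl fun n _ => ?_
    rw [Nat.add_sub_cancel, Complex.real_smul, Complex.real_smul, Nat.factorial_succ]
    have : ((n : ℂ) + 1) ≠ 0 := by exact_mod_cast n.succ_ne_zero
    have : ((n.factorial : ℕ) : ℂ) ≠ 0 := by exact_mod_cast n.factorial_ne_zero
    push_cast
    field_simp

theorem sliceEmb_smul {I : ℍ[ℝ]} (hI : I ∈ imSphere) (r : ℝ) (w : ℂ) :
    sliceEmb I (r • w) = r • sliceEmb I w := by
  simpa only [sliceHom_apply] using map_smul (sliceHom ⟨I, hI⟩) r w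

theorem truncExp_sliceEmb {I : ℍ[ℝ]} (hI : I ∈ imSphere) (k : ℕ∞) (w : ℂ) :
    truncExp k (sliceEmb I w) = sliceEmb I (complexTruncExp k w) := by
  rw [truncExp, complexTruncExp]
  split_ifs
  · rw [sliceEmb_exp hI]
  · rw [← sliceHom_apply ⟨I, hI⟩, ← sliceHom_apply ⟨I, hI⟩, map_sum]
    simp only [map_smul, map_pow]

/-- In the lower half plane the argument and the unit `q.im / |q.im|` both change sign, so the
quaternionic logarithm is the complex one on every slice. -/
theorem qlog_sliceEmb {I : ℍ[ℝ]} (hI : I ∈ imSphere) {w : ℂ} (hw : w ∈ Complex.slitPlane) :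
    qlog (sliceEmb I w) = sliceEmb I (Complex.log w) := by
  rw [qlog, norm_im_sliceEmb hI, norm_sliceEmb hI, re_sliceEmb hI, im_sliceEmb hI, sliceEmb_eq,
    Complex.log_re, Complex.log_im, smul_smul]
  congr 2
  rcases lt_trichotomy w.im 0 with h | h | h
  · have hc : (⟨w.re, |w.im|⟩ : ℂ) = (starRingEnd ℂ) w := by
      apply Complex.ext <;> simp [abs_of_neg h]
    rw [hc, Complex.arg_conj, if_neg (Complex.mem_slitPlane_iff_arg.1 hw).1, abs_of_neg h]
    field_simp [h.ne]
  · have hre : 0 < w.re := by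
      rcases Complex.mem_slitPlane_iff.1 hw with h' | h'
      · exact h'
      · exact absurd h h'
    rw [h, mul_zero, eq_comm, Complex.arg_eq_zero_iff]
    exact ⟨hre.le, h⟩
  · rw [abs_of_pos h]
    field_simp

theorem qpow_sliceEmb {I : ℍ[ℝ]} (hI : I ∈ imSphere) {w : ℂ} (hw : w ∈ Complex.slitPlane)
    (α : ℝ) : qpow (sliceEmb I w) α = sliceEmb I (w ^ (α : ℂ)) := by
  rw [qpow, qlog_sliceEmb hI hw, ← sliceEmb_smul hI, ← sliceEmb_exp hI,
    Complex.cpow_def_of_ne_zero (Complex.slitPlane_ne_zero hw), Complex.real_smul, mul_comm]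

/-- The fractal measure `w ↦ e_k(w ^ α)` in a slice coordinate. -/
def fractalMeasure (α : ℝ) (k : ℕ∞) (w : ℂ) : ℂ := complexTruncExp k (w ^ (α : ℂ))

theorem truncExp_qpow_sliceEmb {I : ℍ[ℝ]} (hI : I ∈ imSphere) {w : ℂ}
    (hw : w ∈ Complex.slitPlane) (α : ℝ) (k : ℕ∞) :
    truncExp k (qpow (sliceEmb I w) α) = sliceEmb I (fractalMeasure α k w) := by
  rw [qpow_sliceEmb hI hw, truncExp_sliceEmb hI, fractalMeasure]

theorem hasDerivAt_fractalMeasure {α : ℝ} {k : ℕ∞} (hk : 1 ≤ k) {w : ℂ}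
    (hw : w ∈ Complex.slitPlane) :
    HasDerivAt (fractalMeasure α k)
      (complexTruncExp (k - 1) (w ^ (α : ℂ)) * (α * w ^ ((α : ℂ) - 1))) w := by
  have h := (hasDerivAt_id w).cpow_const (c := (α : ℂ)) hw
  have h' := (hasDerivAt_complexTruncExp hk (w ^ (α : ℂ))).comp w h
  rw [id_eq, mul_one] at h'
  exact h'

theorem differentiableOn_fractalMeasure {α : ℝ} {k : ℕ∞} (hk : 1 ≤ k) :
    DifferentiableOn ℂ (fractalMeasure α k) slitDisc := fun _ hw =>
  (hasDerivAt_fractalMeasure hk hw.2).differentiableAt.differentiableWithinAt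

/-- The derivative of the fractal measure has no zeros because `e_{k-1}(q ^ α)` has none; since all
slices are alike, it suffices to know this on one of them. -/
theorem deriv_fractalMeasure_ne_zero {α : ℝ} (hα : 0 < α) {k : ℕ∞} (hk : 1 ≤ k)
    (hne : ∀ q ∈ domE, truncExp (k - 1) (qpow q α) ≠ 0) {I : ℍ[ℝ]} (hI : I ∈ imSphere)
    {w : ℂ} (hw : w ∈ slitDisc) : deriv (fractalMeasure α k) w ≠ 0 := by
  rw [(hasDerivAt_fractalMeasure hk hw.2).deriv]
  refine mul_ne_zero (fun h0 => ?_) (mul_ne_zero (by exact_mod_cast hα.ne') ?_)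
  · refine hne _ ((sliceEmb_mem_domE hI).2 hw) ?_
    rw [truncExp_qpow_sliceEmb hI hw.2, fractalMeasure, h0]
    simp [sliceEmb]
  · rw [Complex.cpow_def_of_ne_zero (Complex.slitPlane_ne_zero hw.2)]
    exact Complex.exp_ne_zero _

/-! ### The quaternions as a complex Banach space -/

/-- The quaternions as a complex Banach space, the plane `ℂ(I)` acting by multiplication from the
left. Slice regular functions restrict to holomorphic functions `ℂ → LeftSlice I`. -/
def LeftSlice (_ : imSphere) : Type := ℍ[ℝ]

section LeftSlice

variable (I : imSphere)

instance : NormedAddCommGroup (LeftSlice I) := inferInstanceAs (NormedAddCommGroup ℍ[ℝ])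

instance : CompleteSpace (LeftSlice I) := inferInstanceAs (CompleteSpace ℍ[ℝ])

instance : Module ℂ (LeftSlice I) := Module.compHom ℍ[ℝ] (sliceHom I : ℂ →+* ℍ[ℝ])

instance : NormedSpace ℂ (LeftSlice I) where
  norm_smul_le w q :=
    (norm_mul (sliceHom I w) (id q : ℍ[ℝ])).le.trans_eq
      (congrArg (· * ‖q‖) (by rw [sliceHom_apply, norm_sliceEmb I.2]))

/-- The identity map, from the quaternions to `LeftSlice I`. -/
def toLeft : ℍ[ℝ] ≃ₗᵢ[ℝ] LeftSlice I where
  toFun q := q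
  invFun q := q
  map_add' _ _ := rfl
  map_smul' r q := by
    change r • q = sliceHom I (r : ℂ) * q
    rw [sliceHom_apply, sliceEmb_ofReal, Quaternion.coe_mul_eq_smul]
  left_inv _ := rfl
  right_inv _ := rfl
  norm_map' _ := rfl

theorem smul_toLeft (w : ℂ) (q : ℍ[ℝ]) : w • toLeft I q = toLeft I (sliceEmb I w * q) := by
  rw [← sliceHom_apply]
  rfl

theorem toLeft_symm_smul (w : ℂ) (q : LeftSlice I) :
    (toLeft I).symm (w • q) = sliceEmb I w * (toLeft I).symm q := by
  rw [← sliceHom_apply]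
  rfl

end LeftSlice

/-! ### Slice regularity as holomorphy on the slices -/

theorem ext_apply (f : domE → ℍ[ℝ]) (q : domE) : ext f q = f q :=
  Subtype.val_injective.extend_apply f (0 : ℍ[ℝ] → ℍ[ℝ]) q

theorem ext_of_notMem (f : domE → ℍ[ℝ]) {q : ℍ[ℝ]} (hq : q ∉ domE) : ext f q = 0 :=
  Function.extend_apply' f (0 : ℍ[ℝ] → ℍ[ℝ]) q fun ⟨a, ha⟩ => hq (ha ▸ a.2)

theorem ext_add (f g : domE → ℍ[ℝ]) : ext (f + g) = ext f + ext g := by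
  funext q
  by_cases hq : q ∈ domE
  · simp only [Pi.add_apply, ext_apply _ ⟨q, hq⟩]
  · simp [ext_of_notMem _ hq]

theorem ext_sub (f g : domE → ℍ[ℝ]) : ext (f - g) = ext f - ext g := by
  funext q
  by_cases hq : q ∈ domE
  · simp only [Pi.sub_apply, ext_apply _ ⟨q, hq⟩]
  · simp [ext_of_notMem _ hq]

theorem ext_op_smul (a : ℍ[ℝ]) (f : domE → ℍ[ℝ]) :
    ext (MulOpposite.op a • f) = fun q => ext f q * a := by
  funext q
  by_cases hq : q ∈ domE
  · simp only [Pi.smul_apply, ext_apply _ ⟨q, hq⟩, op_smul_eq_mul]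
  · simp [ext_of_notMem _ hq]

/-- The restriction of a function on `domE` to a slice, as a function of a complex variable with
values in the complex Banach space `LeftSlice I`. -/
def sliceFun (I : imSphere) (f : domE → ℍ[ℝ]) (w : ℂ) : LeftSlice I :=
  toLeft I (ext f (sliceEmb I w))

/-- The embedding of the complex plane `ℂ(I)` as a continuous real linear map. -/
def sliceCLM (I : imSphere) : ℂ →L[ℝ] ℍ[ℝ] := (sliceHom I).toLinearMap.toContinuousLinearMap

theorem sliceCLM_apply (I : imSphere) (w : ℂ) : sliceCLM I w = sliceEmb I w := sliceHom_apply I w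

/-- The Cauchy-Riemann equation of slice regularity at a point of the slice `ℂ(I)` says that the
restriction to this slice is complex differentiable. -/
theorem cauchyRiemann_iff_differentiableAt (I : imSphere) {f : domE → ℍ[ℝ]} {w : ℂ}
    (hf : DifferentiableAt ℝ (ext f) (sliceEmb I w)) :
    deriv (fun t : ℝ => ext f ((t : ℍ[ℝ]) + I * (w.im : ℍ[ℝ]))) w.re
        + I * deriv (fun t : ℝ => ext f ((w.re : ℍ[ℝ]) + I * (t : ℍ[ℝ]))) w.im = 0 ↔
      DifferentiableAt ℂ (sliceFun I f) w := by
  set D := fderiv ℝ (ext f) (sliceEmb I w)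
  have hD : HasFDerivAt (ext f) D (sliceEmb I w) := hf.hasFDerivAt
  have hcoe : ∀ t : ℝ, HasDerivAt (fun t : ℝ => (t : ℍ[ℝ])) 1 t := fun t => by
    rw [show (fun t : ℝ => (t : ℍ[ℝ])) = fun t => t • (1 : ℍ[ℝ]) from
      funext fun t => by rw [← Quaternion.coe_mul_eq_smul, mul_one]]
    simpa using (hasDerivAt_id t).smul_const (1 : ℍ[ℝ])
  have h1 : HasDerivAt (fun t : ℝ => ext f ((t : ℍ[ℝ]) + I * (w.im : ℍ[ℝ]))) (D 1) w.re := by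
    exact hD.comp_hasDerivAt w.re ((hcoe w.re).add_const _)
  have h2 : HasDerivAt (fun t : ℝ => ext f ((w.re : ℍ[ℝ]) + I * (t : ℍ[ℝ]))) (D I) w.im := by
    have h := ((hcoe w.im).const_mul (I : ℍ[ℝ])).const_add (w.re : ℍ[ℝ])
    rw [mul_one] at h
    exact hD.comp_hasDerivAt w.im h
  have h3 : HasFDerivAt (𝕜 := ℝ) (sliceFun I f)
      ((((toLeft I).toContinuousLinearEquiv : ℍ[ℝ] →L[ℝ] LeftSlice I).comp D).comp
        (sliceCLM I)) w := by
    have hs : HasFDerivAt (𝕜 := ℝ) (sliceEmb I) (sliceCLM I) w := by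
      have := (sliceCLM I).hasFDerivAt (x := w)
      rwa [show ⇑(sliceCLM I) = sliceEmb I from funext (sliceCLM_apply I)] at this
    exact ((toLeft I).toContinuousLinearEquiv.hasFDerivAt.comp _ hD).comp w hs
  have hI : (I : ℍ[ℝ]) * I = -1 := mul_self_of_mem_imSphere I.2
  have e1 : sliceEmb I 1 = 1 := by simp [sliceEmb]
  have eI : sliceEmb I Complex.I = I := by simp [sliceEmb]
  rw [h1.deriv, h2.deriv, differentiableAt_complex_iff_differentiableAt_real,
    and_iff_right h3.differentiableAt, h3.fderiv]
  simp only [ContinuousLinearMap.comp_apply, sliceCLM_apply, e1, eI]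
  change _ ↔ toLeft I (D I) = Complex.I • toLeft I (D 1)
  rw [smul_toLeft, eI, (toLeft I).injective.eq_iff]
  constructor
  · intro h
    rw [eq_neg_of_add_eq_zero_left h, mul_neg, ← mul_assoc, hI, neg_one_mul, neg_neg]
  · intro h
    rw [h, ← mul_assoc, hI, neg_one_mul, add_neg_cancel]

theorem mem_SR_iff {f : domE → ℍ[ℝ]} :
    f ∈ SR ↔ DifferentiableOn ℝ (ext f) domE ∧
      ∀ I : imSphere, DifferentiableOn ℂ (sliceFun I f) slitDisc := by
  refine and_congr_right fun hf => ⟨fun h I w hw => ?_, fun h I hI x y hxy => ?_⟩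
  · have hw' := (sliceEmb_mem_domE I.2).2 hw
    exact ((cauchyRiemann_iff_differentiableAt I (hf.differentiableAt
      (isOpen_domE.mem_nhds hw'))).1 (h I I.2 w.re w.im hw')).differentiableWithinAt
  · have hw : (⟨x, y⟩ : ℂ) ∈ slitDisc := (sliceEmb_mem_domE hI).1 hxy
    exact (cauchyRiemann_iff_differentiableAt ⟨I, hI⟩ (w := ⟨x, y⟩) (hf.differentiableAt
      (isOpen_domE.mem_nhds hxy))).2 ((h ⟨I, hI⟩).differentiableAt (isOpen_slitDisc.mem_nhds hw))

theorem differentiableOn_sliceFun {f : domE → ℍ[ℝ]} (hf : f ∈ SR) (I : imSphere) :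
    DifferentiableOn ℂ (sliceFun I f) slitDisc := (mem_SR_iff.1 hf).2 I

theorem sliceFun_add (I : imSphere) (f g : domE → ℍ[ℝ]) :
    sliceFun I (f + g) = sliceFun I f + sliceFun I g := by
  funext w
  simp [sliceFun, ext_add]

theorem sliceFun_sub (I : imSphere) (f g : domE → ℍ[ℝ]) :
    sliceFun I (f - g) = sliceFun I f - sliceFun I g := by
  funext w
  simp [sliceFun, ext_sub]

/-- Multiplication from the right by a quaternion, which is linear over `ℂ(I)`. -/
def mulRightCLM (I : imSphere) (a : ℍ[ℝ]) : LeftSlice I →L[ℂ] LeftSlice I :=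
  LinearMap.mkContinuous
    { toFun := fun q => toLeft I ((toLeft I).symm q * a)
      map_add' := fun p q => by simp [add_mul]
      map_smul' := fun w q => by simp [toLeft_symm_smul, smul_toLeft, mul_assoc] }
    ‖a‖ fun q => by simp [mul_comm]

theorem sliceFun_op_smul (I : imSphere) (a : ℍ[ℝ]) (f : domE → ℍ[ℝ]) :
    sliceFun I (MulOpposite.op a • f) = fun w => mulRightCLM I a (sliceFun I f w) := by
  funext w
  simp [sliceFun, ext_op_smul, mulRightCLM]

theorem zero_mem_SR : (0 : domE → ℍ[ℝ]) ∈ SR := by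
  have h : ext (0 : domE → ℍ[ℝ]) = 0 := by
    simpa using ext_sub (0 : domE → ℍ[ℝ]) 0
  rw [mem_SR_iff, h]
  refine ⟨differentiableOn_const 0, fun I => ?_⟩
  have : sliceFun I 0 = 0 := by
    simpa using sliceFun_sub I 0 0
  rw [this]
  exact differentiableOn_const 0

theorem add_mem_SR {f g : domE → ℍ[ℝ]} (hf : f ∈ SR) (hg : g ∈ SR) : f + g ∈ SR := by
  rw [mem_SR_iff] at *
  refine ⟨?_, fun I => ?_⟩
  · rw [ext_add]
    exact hf.1.add hg.1
  · rw [sliceFun_add]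
    exact (hf.2 I).add (hg.2 I)

theorem op_smul_mem_SR {f : domE → ℍ[ℝ]} (hf : f ∈ SR) (a : ℍ[ℝ]) :
    MulOpposite.op a • f ∈ SR := by
  rw [mem_SR_iff] at *
  refine ⟨?_, fun I => ?_⟩
  · rw [ext_op_smul]
    exact hf.1.mul_const a
  · rw [sliceFun_op_smul]
    exact (mulRightCLM I a).differentiable.comp_differentiableOn (hf.2 I)

theorem sub_mem_SR {f g : domE → ℍ[ℝ]} (hf : f ∈ SR) (hg : g ∈ SR) : f - g ∈ SR := by
  have h := add_mem_SR hf (op_smul_mem_SR hg (-1))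
  have : MulOpposite.op (-1 : ℍ[ℝ]) • g = -g := by
    funext q
    simp
  rwa [this, ← sub_eq_add_neg] at h

/-! ### Identity principle and extension from a slice -/

/-- Every quaternion lies in some plane `ℂ(J)`, with coordinate `re q + √-1 |im q|`. The given `i`
serves for the real quaternions, which lie in all of them. -/
theorem exists_sliceEmb_eq (i : imSphere) (q : ℍ[ℝ]) :
    ∃ J : imSphere, sliceEmb J ⟨q.re, ‖q.im‖⟩ = q := by
  by_cases h : q.im = 0
  · refine ⟨i, ?_⟩
    rw [sliceEmb_eq, h, norm_zero, zero_smul, add_zero]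
    conv_rhs => rw [← q.re_add_im, h, add_zero]
  · have h' : ‖q.im‖ ≠ 0 := norm_ne_zero_iff.2 h
    refine ⟨⟨‖q.im‖⁻¹ • q.im, by simp, ?_⟩, ?_⟩
    · rw [norm_smul, norm_inv, norm_norm, inv_mul_cancel₀ h']
    · rw [sliceEmb_eq]
      simp only
      rw [smul_inv_smul₀ h', q.re_add_im]

/-- A slice regular function which vanishes on one slice vanishes on the real interval common to
all slices, hence everywhere. -/
theorem eq_zero_of_sliceFun_eqOn_zero (i : imSphere) {f : domE → ℍ[ℝ]} (hf : f ∈ SR)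
    (h : Set.EqOn (sliceFun i f) 0 slitDisc) : f = 0 := by
  funext q
  obtain ⟨J, hJ⟩ := exists_sliceEmb_eq i q
  have hw := (sliceEmb_mem_domE J.2).1 (hJ ▸ q.2)
  have hreal : ∀ᶠ t : ℝ in 𝓝[≠] (1 / 2), sliceFun J f t = 0 := by
    have hev : ∀ᶠ t : ℝ in 𝓝 (1 / 2), (t : ℂ) ∈ slitDisc :=
      Complex.continuous_ofReal.continuousAt.eventually_mem
        (isOpen_slitDisc.mem_nhds half_mem_slitDisc)
    filter_upwards [nhdsWithin_le_nhds hev] with t ht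
    have ht' := h ht
    simp only [sliceFun, sliceEmb_ofReal, Pi.zero_apply, map_eq_zero_iff _ (toLeft i).injective,
      map_eq_zero_iff _ (toLeft J).injective] at ht' ⊢
    exact ht'
  have htend : Tendsto (fun t : ℝ => (t : ℂ)) (𝓝[≠] (1 / 2)) (𝓝[≠] ((1 / 2 : ℝ) : ℂ)) := by
    refine tendsto_nhdsWithin_iff.2
      ⟨(Complex.continuous_ofReal.tendsto _).mono_left nhdsWithin_le_nhds, ?_⟩
    filter_upwards [self_mem_nhdsWithin] with t ht
    exact fun h => ht (Complex.ofReal_injective h)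
  have hz := ((differentiableOn_sliceFun hf J).analyticOnNhd isOpen_slitDisc)
    |>.eqOn_zero_of_preconnected_of_frequently_eq_zero isPreconnected_slitDisc half_mem_slitDisc
      (htend.frequently hreal.frequently)
  have := hz hw
  simp only [sliceFun, hJ, ext_apply, Pi.zero_apply, map_eq_zero_iff _ (toLeft J).injective] at this
  exact this

/-- The extension of a function `G` on the slice `ℂ(i)` by the representation formula
`f(x + J y) = ½ (G(w) + G(w̄)) - ½ J i (G(w) - G(w̄))`, where `w = x + y√-1`. At real points the
imaginary unit `J` is not determined; it is taken to be `0`, which is harmless as `w = w̄` there. -/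
def sliceExtension (i : ℍ[ℝ]) (G : ℂ → ℍ[ℝ]) (q : ℍ[ℝ]) : ℍ[ℝ] :=
  (1 / 2 : ℝ) • (G ⟨q.re, ‖q.im‖⟩ + G ⟨q.re, -‖q.im‖⟩)
    - (1 / 2 : ℝ) • ((‖q.im‖⁻¹ • q.im) * (i * (G ⟨q.re, ‖q.im‖⟩ - G ⟨q.re, -‖q.im‖⟩)))

theorem sliceExtension_sliceEmb (i : ℍ[ℝ]) (G : ℂ → ℍ[ℝ]) {J : ℍ[ℝ]} (hJ : J ∈ imSphere) (w : ℂ) :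
    sliceExtension i G (sliceEmb J w) = (1 / 2 : ℝ) • (G w + G (starRingEnd ℂ w))
      - (1 / 2 : ℝ) • (J * (i * (G w - G (starRingEnd ℂ w)))) := by
  have hc : starRingEnd ℂ w = ⟨w.re, -w.im⟩ := rfl
  rw [sliceExtension, norm_im_sliceEmb hJ, im_sliceEmb hJ, re_sliceEmb hJ, hc]
  rcases lt_trichotomy w.im 0 with h | h | h
  · rw [abs_of_neg h, neg_neg, show (⟨w.re, w.im⟩ : ℂ) = w from rfl, smul_smul,
      show (-w.im)⁻¹ * w.im = -1 by field_simp [h.ne], neg_one_smul,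
      add_comm (G w), ← neg_sub (G w), mul_neg, neg_mul_neg]
  · have : w = ⟨w.re, 0⟩ := Complex.ext rfl h
    rw [h, abs_zero, neg_zero, ← this]
    simp
  · rw [abs_of_pos h, smul_smul, inv_mul_cancel₀ h.ne', one_smul]

theorem sliceExtension_self {i : ℍ[ℝ]} (hi : i ∈ imSphere) (G : ℂ → ℍ[ℝ]) (w : ℂ) :
    sliceExtension i G (sliceEmb i w) = G w := by
  rw [sliceExtension_sliceEmb i G hi, ← mul_assoc, mul_self_of_mem_imSphere hi, neg_one_mul]
  module

/-- The representation formula reproduces affine functions. -/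
theorem sliceExtension_affine {i : ℍ[ℝ]} (hi : i ∈ imSphere) (c₀ c₁ : ℍ[ℝ]) (x : ℝ) (q : ℍ[ℝ]) :
    sliceExtension i (fun w => c₀ + sliceEmb i (w - x) * c₁) q = c₀ + (q - x) * c₁ := by
  obtain ⟨J, hJ⟩ := exists_sliceEmb_eq ⟨i, hi⟩ q
  have hii := mul_self_of_mem_imSphere hi
  conv_lhs => rw [← hJ, sliceExtension_sliceEmb _ _ J.2]
  conv_rhs => rw [← hJ]
  set w : ℂ := ⟨q.re, ‖q.im‖⟩
  have h1 : sliceEmb i (w - x) = ((w.re - x : ℝ) : ℍ[ℝ]) + w.im • i := by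
    rw [sliceEmb_eq]
    simp
  have h2 : sliceEmb i (starRingEnd ℂ w - x) = ((w.re - x : ℝ) : ℍ[ℝ]) - w.im • i := by
    rw [sliceEmb_eq]
    simp [sub_eq_add_neg]
  have h3 : i * (w.im • i * c₁) = -(w.im • c₁) := by
    rw [smul_mul_assoc, mul_smul_comm, ← mul_assoc, hii, neg_one_mul, smul_neg]
  have h4 : i * (c₀ + (((w.re - x : ℝ) : ℍ[ℝ]) + w.im • i) * c₁
      - (c₀ + (((w.re - x : ℝ) : ℍ[ℝ]) - w.im • i) * c₁)) = -((2 * w.im) • c₁) := by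
    rw [show c₀ + (((w.re - x : ℝ) : ℍ[ℝ]) + w.im • i) * c₁
      - (c₀ + (((w.re - x : ℝ) : ℍ[ℝ]) - w.im • i) * c₁) = (2 : ℝ) • (w.im • i * c₁) by
        rw [add_mul, sub_mul]; module, mul_smul_comm, h3]
    module
  rw [h1, h2, h4, sliceEmb_eq]
  simp only [add_mul, sub_mul, mul_neg, mul_smul_comm, smul_mul_assoc, Quaternion.coe_sub]
  module

theorem sliceExtension_sub (i : ℍ[ℝ]) (G H : ℂ → ℍ[ℝ]) (q : ℍ[ℝ]) :
    sliceExtension i (G - H) q = sliceExtension i G q - sliceExtension i H q := by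
  simp only [sliceExtension, Pi.sub_apply, mul_sub]
  module

/-- The factor `‖q.im‖⁻¹ • q.im` has norm at most one, also at real points. -/
theorem norm_sliceExtension_le {i : ℍ[ℝ]} (hi : i ∈ imSphere) (G : ℂ → ℍ[ℝ]) (q : ℍ[ℝ]) :
    ‖sliceExtension i G q‖ ≤ ‖G ⟨q.re, ‖q.im‖⟩‖ + ‖G ⟨q.re, -‖q.im‖⟩‖ := by
  have hu : ‖‖q.im‖⁻¹ • q.im‖ ≤ 1 := by
    rw [norm_smul, norm_inv, norm_norm]
    exact inv_mul_le_one
  have h := norm_sub_le (G ⟨q.re, ‖q.im‖⟩) (G ⟨q.re, -‖q.im‖⟩)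
  have h' := norm_add_le (G ⟨q.re, ‖q.im‖⟩) (G ⟨q.re, -‖q.im‖⟩)
  refine (norm_sub_le _ _).trans ?_
  rw [norm_smul, norm_smul, norm_mul, norm_mul, hi.2, one_mul]
  have := mul_le_of_le_one_left (norm_nonneg (G ⟨q.re, ‖q.im‖⟩ - G ⟨q.re, -‖q.im‖⟩)) hu
  norm_num
  linarith

theorem differentiableAt_toLeft_symm_comp (i : imSphere) {F : ℂ → LeftSlice i} {w : ℂ}
    (hF : DifferentiableAt ℂ F w) :
    DifferentiableAt ℝ (fun w => (toLeft i).symm (F w)) w :=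
  (toLeft i).symm.toContinuousLinearEquiv.differentiable.differentiableAt.comp w
    (hF.restrictScalars ℝ)

/-- Away from the real axis the representation formula is composed of differentiable maps. -/
theorem differentiableAt_sliceExtension_of_im_ne_zero (i : ℍ[ℝ]) {G : ℂ → ℍ[ℝ]} {q : ℍ[ℝ]}
    (hq : q.im ≠ 0) (h₁ : DifferentiableAt ℝ G ⟨q.re, ‖q.im‖⟩)
    (h₂ : DifferentiableAt ℝ G ⟨q.re, -‖q.im‖⟩) :
    DifferentiableAt ℝ (sliceExtension i G) q := by
  have hre : Differentiable ℝ fun q : ℍ[ℝ] => q.re :=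
    let L : ℍ[ℝ] →ₗ[ℝ] ℝ := QuaternionAlgebra.reₗ (-1 : ℝ) 0 (-1)
    L.toContinuousLinearMap.differentiable
  have hcoe : Differentiable ℝ fun t : ℝ => (t : ℍ[ℝ]) :=
    (Algebra.linearMap ℝ ℍ[ℝ]).toContinuousLinearMap.differentiable
  have him : Differentiable ℝ fun q : ℍ[ℝ] => q.im := by
    have h : (fun q : ℍ[ℝ] => q.im) = fun q => q - (q.re : ℍ[ℝ]) :=
      funext fun q => (Quaternion.sub_re_self q).symm
    rw [h]
    exact differentiable_id.sub (hcoe.comp hre)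
  have hn : DifferentiableAt ℝ (fun q : ℍ[ℝ] => ‖q.im‖) q := (him q).norm ℝ hq
  have hw₁ : DifferentiableAt ℝ (fun q : ℍ[ℝ] => (⟨q.re, ‖q.im‖⟩ : ℂ)) q :=
    (Complex.equivRealProdCLM.symm : ℝ × ℝ →L[ℝ] ℂ).differentiableAt.comp q
      ((hre q).prodMk hn)
  have hw₂ : DifferentiableAt ℝ (fun q : ℍ[ℝ] => (⟨q.re, -‖q.im‖⟩ : ℂ)) q :=
    (Complex.equivRealProdCLM.symm : ℝ × ℝ →L[ℝ] ℂ).differentiableAt.comp q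
      ((hre q).prodMk hn.neg)
  have hG₁ : DifferentiableAt ℝ (fun q : ℍ[ℝ] => G ⟨q.re, ‖q.im‖⟩) q := h₁.comp q hw₁
  have hG₂ : DifferentiableAt ℝ (fun q : ℍ[ℝ] => G ⟨q.re, -‖q.im‖⟩) q := h₂.comp q hw₂
  exact ((hG₁.add hG₂).const_smul (1 / 2 : ℝ)).sub
    ((((hn.inv (norm_ne_zero_iff.2 hq)).smul (him q)).mul
      ((hG₁.sub hG₂).const_mul i)).const_smul (1 / 2 : ℝ))

/-- At a real point the extension is differentiable because the representation formula preserves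
the first order Taylor expansion: it reproduces affine functions and bounds remainders. -/
theorem differentiableAt_sliceExtension_ofReal (i : imSphere) {F : ℂ → LeftSlice i} {x : ℝ}
    (hF : DifferentiableAt ℂ F x) :
    DifferentiableAt ℝ (sliceExtension i fun w => (toLeft i).symm (F w)) (x : ℍ[ℝ]) := by
  set G : ℂ → ℍ[ℝ] := fun w => (toLeft i).symm (F w) with hG
  set c₁ := (toLeft i).symm (deriv F x)
  set A : ℂ → ℍ[ℝ] := fun w => G x + sliceEmb i (w - x) * c₁ with hA
  have hx : sliceExtension i G (x : ℍ[ℝ]) = G x := by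
    rw [← sliceEmb_ofReal i, sliceExtension_self i.2]
  have hR : (G - A) =o[𝓝 (x : ℂ)] fun w => w - x := by
    have h := hasDerivAt_iff_isLittleO.1 hF.hasDerivAt
    refine Asymptotics.IsLittleO.congr_left
      (f₁ := fun w => (toLeft i).symm (F w - F x - (w - x) • deriv F x)) ?_ fun w => ?_
    · exact (Asymptotics.isBigO_of_le _ fun w => ((toLeft i).symm.norm_map _).le).trans_isLittleO h
    · simp only [map_sub, toLeft_symm_smul, Pi.sub_apply, hA, hG, c₁]
      abel
  have hnorm : ∀ (q : ℍ[ℝ]) (y : ℝ), |y| = ‖q.im‖ → ‖(⟨q.re, y⟩ : ℂ) - x‖ = ‖q - x‖ := by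
    intro q y hy
    have h := norm_sq_eq_re_sq_add_norm_im_sq (q - x)
    have him : (q - (x : ℍ[ℝ])).im = q.im := by simp
    rw [him, ← hy, sq_abs] at h
    rw [← sq_eq_sq₀ (norm_nonneg _) (norm_nonneg _), h, Complex.sq_norm, Complex.normSq_apply]
    simp
    ring
  have htend : ∀ y : ℍ[ℝ] → ℝ, (∀ q, |y q| = ‖q.im‖) →
      (fun q : ℍ[ℝ] => (G - A) ⟨q.re, y q⟩) =o[𝓝 (x : ℍ[ℝ])] fun q => q - x := by
    intro y hy
    have ht : Tendsto (fun q : ℍ[ℝ] => (⟨q.re, y q⟩ : ℂ)) (𝓝 (x : ℍ[ℝ])) (𝓝 (x : ℂ)) := by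
      rw [tendsto_iff_norm_sub_tendsto_zero]
      simp only [hnorm _ _ (hy _)]
      exact tendsto_iff_norm_sub_tendsto_zero.1 tendsto_id
    exact (hR.comp_tendsto ht).trans_isBigO
      (Asymptotics.isBigO_of_le _ fun q => (hnorm q _ (hy q)).le)
  have h₁ := htend (fun q => ‖q.im‖) fun q => abs_norm _
  have h₂ := htend (fun q => -‖q.im‖) fun q => by rw [abs_neg, abs_norm]
  refine HasFDerivAt.differentiableAt (f' := (ContinuousLinearMap.mul ℝ ℍ[ℝ]).flip c₁) ?_
  refine hasFDerivAt_iff_isLittleO.2 ?_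
  refine Asymptotics.IsBigO.trans_isLittleO ?_ (h₁.norm_left.add h₂.norm_left)
  refine Asymptotics.isBigO_of_le _ fun q => ?_
  have he : sliceExtension i G q - sliceExtension i G x
      - (ContinuousLinearMap.mul ℝ ℍ[ℝ]).flip c₁ (q - x) = sliceExtension i (G - A) q := by
    rw [sliceExtension_sub, hA, sliceExtension_affine i.2, hx]
    simp only [ContinuousLinearMap.flip_apply, ContinuousLinearMap.mul_apply']
    abel
  rw [he]
  exact (norm_sliceExtension_le i.2 _ q).trans (le_abs_self _)

theorem conj_mem_slitDisc {w : ℂ} (hw : w ∈ slitDisc) : starRingEnd ℂ w ∈ slitDisc := by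
  refine ⟨by simpa using hw.1, ?_⟩
  have := Complex.mem_slitPlane_iff.1 hw.2
  rw [Complex.mem_slitPlane_iff]
  simpa using this

/-- Every holomorphic function on the slit disc is the restriction to the slice `ℂ(i)` of a slice
regular function. -/
theorem exists_mem_SR_sliceFun_eqOn (i : imSphere) {F : ℂ → LeftSlice i}
    (hF : DifferentiableOn ℂ F slitDisc) :
    ∃ f ∈ SR, Set.EqOn (sliceFun i f) F slitDisc := by
  set G : ℂ → ℍ[ℝ] := fun w => (toLeft i).symm (F w) with hG
  set f : domE → ℍ[ℝ] := fun q => sliceExtension i G q with hf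
  have hFd : ∀ w ∈ slitDisc, DifferentiableAt ℂ F w := fun w hw =>
    hF.differentiableAt (isOpen_slitDisc.mem_nhds hw)
  have hext : Set.EqOn (ext f) (sliceExtension i G) domE := fun q hq => ext_apply f ⟨q, hq⟩
  refine ⟨f, mem_SR_iff.2 ⟨fun q hq => ?_, fun J w hw => ?_⟩, fun w hw => ?_⟩
  · refine DifferentiableAt.differentiableWithinAt ?_
    refine DifferentiableAt.congr_of_eventuallyEq ?_
      (hext.eventuallyEq_of_mem (isOpen_domE.mem_nhds hq))
    obtain ⟨J, hJ⟩ := exists_sliceEmb_eq i q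
    have hw := (sliceEmb_mem_domE J.2).1 (hJ ▸ hq)
    by_cases him : q.im = 0
    · have hqre : q = (q.re : ℍ[ℝ]) := by
        conv_lhs => rw [← q.re_add_im, him, add_zero]
      have hx : (⟨q.re, ‖q.im‖⟩ : ℂ) = (q.re : ℂ) := by
        rw [him, norm_zero]
        rfl
      rw [hqre]
      exact differentiableAt_sliceExtension_ofReal i (hFd _ (hx ▸ hw))
    · exact differentiableAt_sliceExtension_of_im_ne_zero i him
        (differentiableAt_toLeft_symm_comp i (hFd _ hw))
        (differentiableAt_toLeft_symm_comp i (hFd _ (conj_mem_slitDisc hw)))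
  · have hw' := conj_mem_slitDisc hw
    -- The real derivatives of the two terms `G w` and `G w̄` of the representation formula.
    have hGd : ∀ w ∈ slitDisc, HasFDerivAt G
        (((ContinuousLinearMap.mul ℝ ℍ[ℝ]).flip ((toLeft i).symm (deriv F w))).comp
          (sliceCLM i)) w := fun w hw => by
      have h := (toLeft i).symm.toContinuousLinearEquiv.hasFDerivAt.comp w
        ((hFd w hw).hasDerivAt.hasFDerivAt.restrictScalars ℝ)
      refine h.congr_fderiv ?_
      refine ContinuousLinearMap.ext fun v => ?_
      change (toLeft i).symm (v • deriv F w) = sliceCLM i v * _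
      rw [toLeft_symm_smul, sliceCLM_apply]
    have hconj : HasFDerivAt (fun w => G (starRingEnd ℂ w)) _ w :=
      (hGd _ hw').comp w (Complex.conjCLE : ℂ →L[ℝ] ℂ).hasFDerivAt
    have hsum := (toLeft J).toContinuousLinearEquiv.hasFDerivAt.comp w
      ((((hGd w hw).add hconj).const_smul (1 / 2 : ℝ)).sub
        ((((((hGd w hw).sub hconj).const_mul (i : ℍ[ℝ])).const_mul (J : ℍ[ℝ])).const_smul
          (1 / 2 : ℝ))))
    have hev : sliceFun J f =ᶠ[𝓝 w] fun w => toLeft J ((1 / 2 : ℝ) • (G w + G (starRingEnd ℂ w))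
        - (1 / 2 : ℝ) • (J * (i * (G w - G (starRingEnd ℂ w))))) := by
      filter_upwards [isOpen_slitDisc.mem_nhds hw] with v hv
      rw [sliceFun, hext ((sliceEmb_mem_domE J.2).2 hv), sliceExtension_sliceEmb _ _ J.2]
    have hsf := HasFDerivAt.congr_of_eventuallyEq hsum hev
    refine DifferentiableAt.differentiableWithinAt ?_
    rw [differentiableAt_complex_iff_differentiableAt_real, and_iff_right hsf.differentiableAt,
      hsf.fderiv]
    set A := (toLeft i).symm (deriv F w)
    set B := (toLeft i).symm (deriv F (starRingEnd ℂ w))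
    -- The real derivative of the extension on the slice `ℂ(J)` in an arbitrary direction `v`.
    have hval : ∀ v : ℂ, ∀ D : ℂ →L[ℝ] LeftSlice J,
        HasFDerivAt (sliceFun J f) D w → D v = toLeft J ((1 / 2 : ℝ) •
          (sliceEmb i v * A + sliceEmb i (starRingEnd ℂ v) * B) - (1 / 2 : ℝ) •
            (J * (i * (sliceEmb i v * A - sliceEmb i (starRingEnd ℂ v) * B)))) := by
      intro v D hD
      rw [hD.unique hsf, ← sliceCLM_apply, ← sliceCLM_apply]
      rfl
    have e1 : sliceEmb i 1 = 1 := by simp [sliceEmb]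
    have eI : sliceEmb i Complex.I = i := by simp [sliceEmb]
    have eI' : sliceEmb i (-Complex.I) = -i := by simp [sliceEmb]
    have eJ : sliceEmb J Complex.I = J := by simp [sliceEmb]
    have hii : ∀ q : ℍ[ℝ], (i : ℍ[ℝ]) * (i * q) = -q := fun q => by
      rw [← mul_assoc, mul_self_of_mem_imSphere i.2, neg_one_mul]
    have hJJ : ∀ q : ℍ[ℝ], (J : ℍ[ℝ]) * (J * q) = -q := fun q => by
      rw [← mul_assoc, mul_self_of_mem_imSphere J.2, neg_one_mul]
    rw [hval _ _ hsf, hval _ _ hsf, smul_toLeft, Complex.conj_I, map_one, e1, eI, eI', eJ]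
    congr 1
    simp only [mul_sub, mul_add, neg_mul, mul_neg, one_mul, hii, hJJ, mul_smul_comm]
    module
  · rw [sliceFun, hext ((sliceEmb_mem_domE i.2).2 hw), sliceExtension_self i.2]
    exact (toLeft i).apply_symm_apply _

/-! ### The fractal derivative in slice coordinates -/

theorem map_sliceEmb_nhdsWithin {I : ℍ[ℝ]} (hI : I ∈ imSphere) {w : ℂ} (hw : w ∈ slitDisc) :
    map (sliceEmb I) (𝓝[≠] w) = 𝓝[slice I domE \ {sliceEmb I w}] (sliceEmb I w) := by
  have h : slice I domE \ {sliceEmb I w} = sliceEmb I '' (slitDisc \ {w}) := by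
    rw [slice_domE hI, Set.image_sdiff (isometry_sliceEmb hI).injective, Set.image_singleton]
  rw [h, ← (isometry_sliceEmb hI).isEmbedding.map_nhdsWithin_eq, Set.sdiff_eq,
    nhdsWithin_inter', nhdsWithin_eq_nhds.2 (isOpen_slitDisc.mem_nhds hw)]
  rfl

theorem hasFractalDeriv_sliceEmb {α : ℝ} {k : ℕ∞} {I : imSphere} {f : domE → ℍ[ℝ]} (hf : f ∈ SR)
    {w : ℂ} (hw : w ∈ slitDisc) (hk : 1 ≤ k) (hne : deriv (fractalMeasure α k) w ≠ 0) :
    HasFractalDeriv α k I f (sliceEmb I w)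
      ((toLeft I).symm ((deriv (fractalMeasure α k) w)⁻¹ • deriv (sliceFun I f) w)) := by
  set φ := fractalMeasure α k with hφ
  have h1 : Tendsto (slope φ w) (𝓝[≠] w) (𝓝 (deriv φ w)) :=
    hasDerivAt_iff_tendsto_slope.1 (hasDerivAt_fractalMeasure hk hw.2).differentiableAt.hasDerivAt
  have h2 : Tendsto (slope (sliceFun I f) w) (𝓝[≠] w) (𝓝 (deriv (sliceFun I f) w)) :=
    hasDerivAt_iff_tendsto_slope.1 ((differentiableOn_sliceFun hf I).differentiableAt
      (isOpen_slitDisc.mem_nhds hw)).hasDerivAt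
  have h3 := ((toLeft I).symm.continuous.tendsto _).comp ((h1.inv₀ hne).smul h2)
  rw [HasFractalDeriv, ← map_sliceEmb_nhdsWithin I.2 hw, tendsto_map'_iff]
  refine h3.congr' ?_
  filter_upwards [self_mem_nhdsWithin, nhdsWithin_le_nhds (isOpen_slitDisc.mem_nhds hw)]
    with ζ hζ hζU
  have hζ' : ζ - w ≠ 0 := sub_ne_zero.2 hζ
  simp only [Function.comp_apply, fractalQuot, truncExp_qpow_sliceEmb I.2 hw.2,
    truncExp_qpow_sliceEmb I.2 hζU.2, ← sliceEmb_sub I.2, ← sliceEmb_inv I.2]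
  have h4 : (slope φ w ζ)⁻¹ • slope (sliceFun I f) w ζ
      = (φ w - φ ζ)⁻¹ • (sliceFun I f w - sliceFun I f ζ) := by
    rw [slope_def_module, slope_def_module, smul_smul, smul_eq_mul, mul_inv, inv_inv,
      mul_right_comm, mul_inv_cancel₀ hζ', one_mul, ← neg_sub (φ w), ← neg_sub (sliceFun I f w),
      inv_neg, neg_smul_neg]
  rw [h4, toLeft_symm_smul]
  simp only [sliceFun, map_sub, LinearIsometryEquiv.symm_apply_apply]
  rfl

/-- In the slice coordinate the fractal-fractional derivative is a first order holomorphic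
differential operator. -/
theorem ffDeriv_sliceEmb {α : ℝ} {k : ℕ∞} {I : imSphere} {f : domE → ℍ[ℝ]} (hf : f ∈ SR)
    {w : ℂ} (hw : w ∈ slitDisc) (hk : 1 ≤ k) (hne : deriv (fractalMeasure α k) w ≠ 0) (σ : ℝ) :
    ffDeriv α σ k I f (sliceEmb I w)
      = (toLeft I).symm (mixedDeriv σ (fractalMeasure α k) (sliceFun I f) w) := by
  have hlim := hasFractalDeriv_sliceEmb (I := I) hf hw hk hne
  have hbot : (𝓝[slice I domE \ {sliceEmb I w}] (sliceEmb I w)).NeBot := by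
    rw [← map_sliceEmb_nhdsWithin I.2 hw]
    infer_instance
  rw [ffDeriv, fractalDeriv, Tendsto.limUnder_eq hlim, mixedDeriv, map_add,
    toLeft_symm_smul _ ((1 - σ : ℝ) : ℂ), toLeft_symm_smul _ (σ : ℂ), sliceEmb_ofReal,
    sliceEmb_ofReal, Quaternion.coe_mul_eq_smul,
    Quaternion.coe_mul_eq_smul, sliceFun, LinearIsometryEquiv.symm_apply_apply]

/-! ### The Dirichlet type space in slice coordinates -/

/-- The fractal-fractional derivative in the coordinate of the slice `ℂ(I)`. -/
def sliceDeriv (α σ : ℝ) (k : ℕ∞) (I : imSphere) (f : domE → ℍ[ℝ]) : ℂ → LeftSlice I :=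
  mixedDeriv σ (fractalMeasure α k) (sliceFun I f)

/-- The `L²` norm of the fractal-fractional derivative on a slice. -/
def energyNorm (α σ : ℝ) (k : ℕ∞) (I : imSphere) (f : domE → ℍ[ℝ]) : ℝ :=
  (eLpNorm (sliceDeriv α σ k I f) 2 (volume.restrict slitDisc)).toReal

theorem energyNorm_nonneg (α σ : ℝ) (k : ℕ∞) (I : imSphere) (f : domE → ℍ[ℝ]) :
    0 ≤ energyNorm α σ k I f := ENNReal.toReal_nonneg

variable {α σ : ℝ} {k : ℕ∞} {I : imSphere} {f g : domE → ℍ[ℝ]}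

theorem sliceDeriv_add (hf : f ∈ SR) (hg : g ∈ SR) :
    sliceDeriv α σ k I (f + g)
      =ᵐ[volume.restrict slitDisc] sliceDeriv α σ k I f + sliceDeriv α σ k I g := by
  filter_upwards [ae_restrict_mem isOpen_slitDisc.measurableSet] with w hw
  rw [sliceDeriv, sliceFun_add]
  exact mixedDeriv_add
    ((differentiableOn_sliceFun hf I).differentiableAt (isOpen_slitDisc.mem_nhds hw))
    ((differentiableOn_sliceFun hg I).differentiableAt (isOpen_slitDisc.mem_nhds hw))

theorem sliceDeriv_sub (hf : f ∈ SR) (hg : g ∈ SR) :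
    sliceDeriv α σ k I (f - g)
      =ᵐ[volume.restrict slitDisc] sliceDeriv α σ k I f - sliceDeriv α σ k I g := by
  filter_upwards [ae_restrict_mem isOpen_slitDisc.measurableSet] with w hw
  rw [sliceDeriv, sliceFun_sub]
  exact mixedDeriv_sub
    ((differentiableOn_sliceFun hf I).differentiableAt (isOpen_slitDisc.mem_nhds hw))
    ((differentiableOn_sliceFun hg I).differentiableAt (isOpen_slitDisc.mem_nhds hw))

theorem norm_sliceDeriv_op_smul (hf : f ∈ SR) (a : ℍ[ℝ]) {w : ℂ} (hw : w ∈ slitDisc) :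
    ‖sliceDeriv α σ k I (MulOpposite.op a • f) w‖ = ‖sliceDeriv α σ k I f w‖ * ‖a‖ := by
  rw [sliceDeriv, sliceFun_op_smul, mixedDeriv_clm_comp _
    ((differentiableOn_sliceFun hf I).differentiableAt (isOpen_slitDisc.mem_nhds hw))]
  simp [mulRightCLM, sliceDeriv]

theorem aestronglyMeasurable_sliceDeriv (hk : 1 ≤ k)
    (hφ : ∀ w ∈ slitDisc, deriv (fractalMeasure α k) w ≠ 0) (hf : f ∈ SR) :
    AEStronglyMeasurable (sliceDeriv α σ k I f) (volume.restrict slitDisc) :=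
  (differentiableOn_mixedDeriv isOpen_slitDisc (differentiableOn_fractalMeasure hk) hφ
    (differentiableOn_sliceFun hf I)).continuousOn.aestronglyMeasurable
      isOpen_slitDisc.measurableSet

theorem energyDensity_eq (hk : 1 ≤ k)
    (hφ : ∀ w ∈ slitDisc, deriv (fractalMeasure α k) w ≠ 0) (hf : f ∈ SR) {w : ℂ}
    (hw : w ∈ slitDisc) :
    energyDensity α σ k I f w = ‖sliceDeriv α σ k I f w‖ ^ 2 := by
  rw [energyDensity, ffDeriv_sliceEmb hf hw hk (hφ w hw), LinearIsometryEquiv.norm_map, sliceDeriv]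

theorem mem_dirichletSpace_iff (hk : 1 ≤ k)
    (hφ : ∀ w ∈ slitDisc, deriv (fractalMeasure α k) w ≠ 0) :
    f ∈ dirichletSpace α σ k I ↔
      f ∈ SR ∧ MemLp (sliceDeriv α σ k I f) 2 (volume.restrict slitDisc) := by
  refine and_congr_right fun hf => ?_
  rw [preimage_sliceEmb_domE I.2, integrableOn_congr_fun
    (fun w hw => energyDensity_eq hk hφ hf hw) isOpen_slitDisc.measurableSet,
    memLp_two_iff_integrable_sq_norm (aestronglyMeasurable_sliceDeriv hk hφ hf), IntegrableOn]

/-- The Dirichlet norm is the Euclidean norm of the pair formed by the weighted value at `1/2` and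
the `L²` norm of the derivative. -/
theorem dirichletNorm_eq (hα : 0 ≤ α) (hk : 1 ≤ k)
    (hφ : ∀ w ∈ slitDisc, deriv (fractalMeasure α k) w ≠ 0) (hf : f ∈ dirichletSpace α σ k I) :
    dirichletNorm α σ k I f
      = ‖(⟨√α * ‖ext f ((1 / 2 : ℝ) : ℍ[ℝ])‖, energyNorm α σ k I f⟩ : ℂ)‖ := by
  obtain ⟨hf, hL⟩ := (mem_dirichletSpace_iff hk hφ).1 hf
  have h : ∫ w in sliceEmb I ⁻¹' domE, energyDensity α σ k I f w = energyNorm α σ k I f ^ 2 := by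
    rw [preimage_sliceEmb_domE I.2, setIntegral_congr_fun isOpen_slitDisc.measurableSet
      fun w hw => energyDensity_eq hk hφ hf hw, energyNorm,
      hL.eLpNorm_eq_integral_rpow_norm two_ne_zero ENNReal.ofNat_ne_top]
    have h0 : 0 ≤ ∫ w in slitDisc, ‖sliceDeriv α σ k I f w‖ ^ 2 :=
      integral_nonneg fun w => by positivity
    norm_num
    rw [← Real.sqrt_eq_rpow, ENNReal.toReal_ofReal (Real.sqrt_nonneg _), Real.sq_sqrt h0]
  rw [dirichletNorm, h, ← Real.sqrt_sq (norm_nonneg (_ : ℂ)), Complex.sq_norm,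
    Complex.normSq_apply]
  congr 1
  linear_combination (-‖ext f ((1 / 2 : ℝ) : ℍ[ℝ])‖ ^ 2) * Real.mul_self_sqrt hα

theorem add_mem_dirichletSpace (hk : 1 ≤ k)
    (hφ : ∀ w ∈ slitDisc, deriv (fractalMeasure α k) w ≠ 0) (hf : f ∈ dirichletSpace α σ k I)
    (hg : g ∈ dirichletSpace α σ k I) : f + g ∈ dirichletSpace α σ k I := by
  rw [mem_dirichletSpace_iff hk hφ] at *
  exact ⟨add_mem_SR hf.1 hg.1, (memLp_congr_ae (sliceDeriv_add hf.1 hg.1)).2 (hf.2.add hg.2)⟩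

theorem sub_mem_dirichletSpace (hk : 1 ≤ k)
    (hφ : ∀ w ∈ slitDisc, deriv (fractalMeasure α k) w ≠ 0) (hf : f ∈ dirichletSpace α σ k I)
    (hg : g ∈ dirichletSpace α σ k I) : f - g ∈ dirichletSpace α σ k I := by
  rw [mem_dirichletSpace_iff hk hφ] at *
  exact ⟨sub_mem_SR hf.1 hg.1, (memLp_congr_ae (sliceDeriv_sub hf.1 hg.1)).2 (hf.2.sub hg.2)⟩

theorem op_smul_mem_dirichletSpace (hk : 1 ≤ k)
    (hφ : ∀ w ∈ slitDisc, deriv (fractalMeasure α k) w ≠ 0) (hf : f ∈ dirichletSpace α σ k I)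
    (a : ℍ[ℝ]) : MulOpposite.op a • f ∈ dirichletSpace α σ k I := by
  rw [mem_dirichletSpace_iff hk hφ] at *
  refine ⟨op_smul_mem_SR hf.1 a, (hf.2.norm.mul_const ‖a‖).congr_norm
    (aestronglyMeasurable_sliceDeriv hk hφ (op_smul_mem_SR hf.1 a)) ?_⟩
  filter_upwards [ae_restrict_mem isOpen_slitDisc.measurableSet] with w hw
  rw [norm_sliceDeriv_op_smul hf.1 a hw, norm_mul, norm_norm, norm_norm]

theorem sliceDeriv_zero : sliceDeriv α σ k I 0 = 0 := by
  have h : sliceFun I 0 = 0 := by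
    simpa using sliceFun_sub I 0 0
  funext w
  rw [sliceDeriv, h]
  simp [mixedDeriv]

theorem zero_mem_dirichletSpace (hk : 1 ≤ k)
    (hφ : ∀ w ∈ slitDisc, deriv (fractalMeasure α k) w ≠ 0) :
    (0 : domE → ℍ[ℝ]) ∈ dirichletSpace α σ k I := by
  rw [mem_dirichletSpace_iff hk hφ, sliceDeriv_zero]
  exact ⟨zero_mem_SR, MemLp.zero⟩

theorem dirichletNorm_add_le (hα : 0 ≤ α) (hk : 1 ≤ k)
    (hφ : ∀ w ∈ slitDisc, deriv (fractalMeasure α k) w ≠ 0) (hf : f ∈ dirichletSpace α σ k I)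
    (hg : g ∈ dirichletSpace α σ k I) :
    dirichletNorm α σ k I (f + g) ≤ dirichletNorm α σ k I f + dirichletNorm α σ k I g := by
  have hv : √α * ‖ext (f + g) ((1 / 2 : ℝ) : ℍ[ℝ])‖
      ≤ √α * ‖ext f ((1 / 2 : ℝ) : ℍ[ℝ])‖ + √α * ‖ext g ((1 / 2 : ℝ) : ℍ[ℝ])‖ := by
    rw [ext_add, ← mul_add]
    exact mul_le_mul_of_nonneg_left (norm_add_le _ _) (Real.sqrt_nonneg _)
  have he : energyNorm α σ k I (f + g) ≤ energyNorm α σ k I f + energyNorm α σ k I g := by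
    obtain ⟨hf, hfL⟩ := (mem_dirichletSpace_iff hk hφ).1 hf
    obtain ⟨hg, hgL⟩ := (mem_dirichletSpace_iff hk hφ).1 hg
    rw [energyNorm, eLpNorm_congr_ae (sliceDeriv_add hf hg), energyNorm, energyNorm,
      ← ENNReal.toReal_add hfL.2.ne hgL.2.ne]
    exact ENNReal.toReal_mono (ENNReal.add_ne_top.2 ⟨hfL.2.ne, hgL.2.ne⟩)
      (eLpNorm_add_le hfL.1 hgL.1 one_le_two)
  rw [dirichletNorm_eq hα hk hφ (add_mem_dirichletSpace hk hφ hf hg), dirichletNorm_eq hα hk hφ hf,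
    dirichletNorm_eq hα hk hφ hg]
  -- The triangle inequality in the plane, combined with monotonicity in both coordinates.
  refine le_trans ?_ (norm_add_le _ _)
  have h0 : 0 ≤ √α * ‖ext (f + g) ((1 / 2 : ℝ) : ℍ[ℝ])‖ := by positivity
  have h1 := energyNorm_nonneg α σ k I (f + g)
  rw [← sq_le_sq₀ (norm_nonneg _) (norm_nonneg _), Complex.sq_norm, Complex.sq_norm,
    Complex.normSq_apply, Complex.normSq_apply]
  exact add_le_add (mul_self_le_mul_self h0 hv) (mul_self_le_mul_self h1 he)

theorem dirichletNorm_op_smul (hk : 1 ≤ k)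
    (hφ : ∀ w ∈ slitDisc, deriv (fractalMeasure α k) w ≠ 0) (hf : f ∈ dirichletSpace α σ k I)
    (a : ℍ[ℝ]) :
    dirichletNorm α σ k I (MulOpposite.op a • f) = dirichletNorm α σ k I f * ‖a‖ := by
  have h : ∫ w in sliceEmb I ⁻¹' domE, energyDensity α σ k I (MulOpposite.op a • f) w
      = (∫ w in sliceEmb I ⁻¹' domE, energyDensity α σ k I f w) * ‖a‖ ^ 2 := by
    rw [← integral_mul_const, preimage_sliceEmb_domE I.2]
    refine setIntegral_congr_fun isOpen_slitDisc.measurableSet fun w hw => ?_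
    rw [energyDensity_eq hk hφ (op_smul_mem_SR hf.1 a) hw, energyDensity_eq hk hφ hf.1 hw,
      norm_sliceDeriv_op_smul hf.1 a hw, mul_pow]
  rw [dirichletNorm, dirichletNorm, h, ext_op_smul, norm_mul]
  conv_rhs => rw [← Real.sqrt_sq (norm_nonneg a)]
  rw [← Real.sqrt_mul' _ (sq_nonneg ‖a‖)]
  congr 1
  ring

/-- This bound is where the positivity of the weight `α` is needed. -/
theorem norm_ext_half_le (hα : 0 < α) (hk : 1 ≤ k)
    (hφ : ∀ w ∈ slitDisc, deriv (fractalMeasure α k) w ≠ 0) (hf : f ∈ dirichletSpace α σ k I) :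
    ‖ext f ((1 / 2 : ℝ) : ℍ[ℝ])‖ ≤ (√α)⁻¹ * dirichletNorm α σ k I f := by
  rw [← div_eq_inv_mul, le_div_iff₀' (Real.sqrt_pos.2 hα), dirichletNorm_eq hα.le hk hφ hf]
  exact (le_abs_self _).trans (Complex.abs_re_le_norm
    (⟨√α * ‖ext f ((1 / 2 : ℝ) : ℍ[ℝ])‖, energyNorm α σ k I f⟩ : ℂ))

theorem energyNorm_le (hα : 0 ≤ α) (hk : 1 ≤ k)
    (hφ : ∀ w ∈ slitDisc, deriv (fractalMeasure α k) w ≠ 0) (hf : f ∈ dirichletSpace α σ k I) :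
    energyNorm α σ k I f ≤ dirichletNorm α σ k I f := by
  rw [dirichletNorm_eq hα hk hφ hf]
  exact (le_abs_self _).trans (Complex.abs_im_le_norm
    (⟨√α * ‖ext f ((1 / 2 : ℝ) : ℍ[ℝ])‖, energyNorm α σ k I f⟩ : ℂ))

theorem dirichletNorm_eq_zero_iff (hα : 0 < α) (hσ : σ ≠ 0) (hk : 1 ≤ k)
    (hφ : ∀ w ∈ slitDisc, deriv (fractalMeasure α k) w ≠ 0) (hf : f ∈ dirichletSpace α σ k I) :
    dirichletNorm α σ k I f = 0 ↔ f = 0 := by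
  constructor
  · intro h0
    have h1 := norm_ext_half_le hα hk hφ hf
    have h2 := energyNorm_le hα.le hk hφ hf
    rw [h0, mul_zero] at h1
    rw [h0] at h2
    obtain ⟨hfS, hL⟩ := (mem_dirichletSpace_iff hk hφ).1 hf
    refine eq_zero_of_sliceFun_eqOn_zero I hfS fun w hw => ?_
    obtain ⟨C, hC0, hC⟩ := exists_norm_le_of_isCompact (X := LeftSlice I) hσ isOpen_slitDisc
      starConvex_slitDisc (differentiableOn_fractalMeasure hk) hφ (isCompact_singleton (x := w))
      (by simpa using hw)
    have h3 := hC _ (differentiableOn_sliceFun hfS I) hL w rfl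
    have h4 : ‖sliceFun I f ((1 / 2 : ℝ) : ℂ)‖ ≤ 0 := by
      rw [sliceFun, LinearIsometryEquiv.norm_map, sliceEmb_ofReal]
      exact h1
    have h5 : ‖sliceFun I f w‖ ≤ C * 0 :=
      h3.trans (mul_le_mul_of_nonneg_left (add_nonpos h4 h2) hC0)
    rw [mul_zero] at h5
    exact norm_le_zero_iff.1 h5
  · rintro rfl
    have h : ext (0 : domE → ℍ[ℝ]) = 0 := by
      simpa using ext_sub (0 : domE → ℍ[ℝ]) 0
    rw [dirichletNorm_eq hα.le hk hφ hf, energyNorm, sliceDeriv_zero, h]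
    simp
    rfl

theorem dirichletNorm_le_add (hα : 0 ≤ α) (hk : 1 ≤ k)
    (hφ : ∀ w ∈ slitDisc, deriv (fractalMeasure α k) w ≠ 0) (hf : f ∈ dirichletSpace α σ k I) :
    dirichletNorm α σ k I f
      ≤ √α * ‖ext f ((1 / 2 : ℝ) : ℍ[ℝ])‖ + energyNorm α σ k I f := by
  rw [dirichletNorm_eq hα hk hφ hf]
  refine (Complex.norm_le_abs_re_add_abs_im _).trans_eq ?_
  simp only
  rw [abs_of_nonneg (by positivity), abs_of_nonneg (energyNorm_nonneg α σ k I f)]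

/-- Completeness: the slice restrictions of a Cauchy sequence converge to a holomorphic function
together with their derivatives, this limit extends to a slice regular function, and Fatou's lemma
turns pointwise convergence of the derivatives into convergence in `L²`. -/
theorem exists_tendsto_dirichletNorm (hα : 0 < α) (hσ : σ ≠ 0) (hk : 1 ≤ k)
    (hφ : ∀ w ∈ slitDisc, deriv (fractalMeasure α k) w ≠ 0) (u : ℕ → domE → ℍ[ℝ])
    (hu : ∀ n, u n ∈ dirichletSpace α σ k I)
    (hcauchy : ∀ ε > 0, ∃ n₀, ∀ m ≥ n₀, ∀ n ≥ n₀, dirichletNorm α σ k I (u m - u n) < ε) :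
    ∃ f ∈ dirichletSpace α σ k I,
      Tendsto (fun n => dirichletNorm α σ k I (u n - f)) atTop (𝓝 0) := by
  have hu' := fun n => (mem_dirichletSpace_iff hk hφ).1 (hu n)
  have hsub := fun m n => sub_mem_dirichletSpace hk hφ (hu m) (hu n)
  have hα' : 0 < √α := Real.sqrt_pos.2 hα
  have hhalf : ∀ h : domE → ℍ[ℝ], sliceFun I h ((1 / 2 : ℝ) : ℂ)
      = toLeft I (ext h ((1 / 2 : ℝ) : ℍ[ℝ])) := fun h => by rw [sliceFun, sliceEmb_ofReal]
  obtain ⟨G, hG, hptG, hptD⟩ := exists_limit_of_cauchy_mixedDeriv hσ isOpen_slitDisc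
    starConvex_slitDisc (differentiableOn_fractalMeasure hk) hφ (fun n => sliceFun I (u n))
    (fun n => differentiableOn_sliceFun (hu' n).1 I) (fun n => (hu' n).2) (by
      intro ε hε
      -- The value at `1/2` costs a factor `(√α)⁻¹` and the `L²` norm a factor `1`.
      obtain ⟨n₀, hn₀⟩ := hcauchy (ε / ((√α)⁻¹ + 1)) (by positivity)
      refine ⟨n₀, fun m hm n hn => ?_⟩
      have h := hn₀ m hm n hn
      rw [lt_div_iff₀ (by positivity)] at h
      have h1 := norm_ext_half_le hα hk hφ (hsub m n)
      have h2 := energyNorm_le hα.le hk hφ (hsub m n)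
      rw [energyNorm, eLpNorm_congr_ae (sliceDeriv_sub (hu' m).1 (hu' n).1)] at h2
      rw [hhalf, hhalf, ← map_sub, LinearIsometryEquiv.norm_map]
      rw [ext_sub] at h1
      refine (add_le_add h1 h2).trans_lt ?_
      linarith)
  obtain ⟨f, hf, hfG⟩ := exists_mem_SR_sliceFun_eqOn I hG
  have hD : Set.EqOn (sliceDeriv α σ k I f) (mixedDeriv σ (fractalMeasure α k) G) slitDisc := by
    intro w hw
    rw [sliceDeriv, mixedDeriv, mixedDeriv, hfG hw,
      (hfG.eventuallyEq_of_mem (isOpen_slitDisc.mem_nhds hw)).deriv_eq]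
  have hfatou : ∀ ε > 0, ∃ n₀, ∀ n ≥ n₀,
      eLpNorm (sliceDeriv α σ k I (u n - f)) 2 (volume.restrict slitDisc) ≤ ENNReal.ofReal ε := by
    intro ε hε
    obtain ⟨n₀, hn₀⟩ := hcauchy ε hε
    refine ⟨n₀, fun n hn => ?_⟩
    refine (Lp.eLpNorm_lim_le_liminf_eLpNorm (f := fun m => sliceDeriv α σ k I (u n - u m))
      (fun m => aestronglyMeasurable_sliceDeriv hk hφ (hsub n m).1) _ ?_).trans ?_
    · have h1 := sliceDeriv_sub (α := α) (σ := σ) (k := k) (I := I) (hu' n).1 hf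
      have h2 : ∀ᵐ w ∂(volume.restrict slitDisc), ∀ m, sliceDeriv α σ k I (u n - u m) w
          = (sliceDeriv α σ k I (u n) - sliceDeriv α σ k I (u m)) w :=
        ae_all_iff.2 fun m => sliceDeriv_sub (hu' n).1 (hu' m).1
      filter_upwards [h1, h2, ae_restrict_mem isOpen_slitDisc.measurableSet] with w h1 h2 hw
      rw [h1]
      simp only [h2, Pi.sub_apply]
      rw [hD hw]
      exact tendsto_const_nhds.sub (hptD w hw)
    · refine liminf_le_of_frequently_le' (Eventually.frequently ?_)
      filter_upwards [eventually_ge_atTop n₀] with m hm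
      have h := (energyNorm_le hα.le hk hφ (hsub n m)).trans (hn₀ n hn m hm).le
      exact (ENNReal.le_ofReal_iff_toReal_le
        ((mem_dirichletSpace_iff hk hφ).1 (hsub n m)).2.2.ne hε.le).2 h
  have hfmem : f ∈ dirichletSpace α σ k I := by
    obtain ⟨n, hn⟩ := hfatou 1 one_pos
    have hnf : u n - f ∈ dirichletSpace α σ k I := (mem_dirichletSpace_iff hk hφ).2
      ⟨sub_mem_SR (hu' n).1 hf, aestronglyMeasurable_sliceDeriv hk hφ (sub_mem_SR (hu' n).1 hf),
        (hn n le_rfl).trans_lt ENNReal.ofReal_lt_top⟩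
    have := sub_mem_dirichletSpace hk hφ (hu n) hnf
    rwa [sub_sub_cancel] at this
  refine ⟨f, hfmem, ?_⟩
  have hval : Tendsto (fun n => √α * ‖ext (u n - f) ((1 / 2 : ℝ) : ℍ[ℝ])‖) atTop (𝓝 0) := by
    have h := hptG _ half_mem_slitDisc
    rw [← hfG half_mem_slitDisc, tendsto_iff_norm_sub_tendsto_zero] at h
    simp only [hhalf, ← map_sub, LinearIsometryEquiv.norm_map] at h
    simpa [ext_sub] using h.const_mul (√α)
  have hen : Tendsto (fun n => energyNorm α σ k I (u n - f)) atTop (𝓝 0) := by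
    rw [Metric.tendsto_atTop]
    intro ε hε
    obtain ⟨n₀, hn₀⟩ := hfatou (ε / 2) (by positivity)
    refine ⟨n₀, fun n hn => ?_⟩
    rw [Real.dist_0_eq_abs, abs_of_nonneg (energyNorm_nonneg α σ k I _)]
    exact (ENNReal.toReal_le_of_le_ofReal (by positivity) (hn₀ n hn)).trans_lt (by linarith)
  refine squeeze_zero (fun n => Real.sqrt_nonneg _)
    (fun n => dirichletNorm_le_add hα.le hk hφ (sub_mem_dirichletSpace hk hφ (hu n) hfmem)) ?_
  simpa using hval.add hen

end

end SliceDirichlet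

theorem mainTheorem3 (α σ : ℝ) (hα₀ : 0 < α) (hα₁ : α ≤ 1) (hσ₀ : 0 < σ) (hσ₁ : σ ≤ 1)
    (k : ℕ∞) (hk : 1 ≤ k)
    (hne : ∀ q ∈ SliceDirichlet.domE,
      SliceDirichlet.truncExp (k - 1) (SliceDirichlet.qpow q α) ≠ 0)
    (i : ℍ[ℝ]) (hi : i ∈ SliceDirichlet.imSphere) :
    (∀ f ∈ SliceDirichlet.SR, ∀ z ∈ SliceDirichlet.slice i SliceDirichlet.domE,
      SliceDirichlet.HasFractalDeriv α k i f z (SliceDirichlet.fractalDeriv α k i f z)) ∧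
    SliceDirichlet.IsBanachRightModule
      (SliceDirichlet.dirichletSpace α σ k i) (SliceDirichlet.dirichletNorm α σ k i) := by
  have hφ : ∀ w ∈ SliceDirichlet.slitDisc, deriv (SliceDirichlet.fractalMeasure α k) w ≠ 0 :=
    fun w hw => SliceDirichlet.deriv_fractalMeasure_ne_zero hα₀ hk hne hi hw
  obtain ⟨I, rfl⟩ : ∃ I : SliceDirichlet.imSphere, (I : ℍ[ℝ]) = i := ⟨⟨i, hi⟩, rfl⟩
  refine ⟨fun f hf z hz => ?_, ?_⟩
  · rw [SliceDirichlet.slice_domE hi] at hz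
    obtain ⟨w, hw, rfl⟩ := hz
    exact tendsto_nhds_limUnder
      ⟨_, SliceDirichlet.hasFractalDeriv_sliceEmb hf hw hk (hφ w hw)⟩
  · exact
    { zero_mem := SliceDirichlet.zero_mem_dirichletSpace hk hφ
      add_mem := fun f hf g hg => SliceDirichlet.add_mem_dirichletSpace hk hφ hf hg
      smul_mem := fun f hf a => SliceDirichlet.op_smul_mem_dirichletSpace hk hφ hf a
      norm_nonneg := fun f _ => Real.sqrt_nonneg _
      norm_eq_zero_iff := fun f hf =>
        SliceDirichlet.dirichletNorm_eq_zero_iff hα₀ hσ₀.ne' hk hφ hf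
      norm_add_le := fun f hf g hg => SliceDirichlet.dirichletNorm_add_le hα₀.le hk hφ hf hg
      norm_smul := fun f hf a => SliceDirichlet.dirichletNorm_op_smul hk hφ hf a
      complete := fun u hu hc =>
        SliceDirichlet.exists_tendsto_dirichletNorm hα₀ hσ₀.ne' hk hφ u hu hc }
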